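/- Let $n\ge 1$ be an integer and let $p_1,\dots,p_n\in\mathbb C$ be the roots, listed with multiplicity, of $$f_n(z)=\sum_{j=0}^n\binom nj^2z^j .$$ Put $p_{n+1}=1$, let $\varepsilon\in\{1,-1\}$, and put $\alpha_1=\dots=\alpha_n=\varepsilon/n$, $\alpha_{n+1}=-\varepsilon$. Then: 1. $f_n$ satisfies $z(1-z)f_n''+(1+(2n-1)z)f_n'-n^2f_n=0$; the points $0,p_1,\dots,p_{n+1}$ are pairwise distinct (in particular, the roots of $f_n$ are simple). 2. The balance equations $$F_k=2\sum_{j\ne k}\frac{\alpha_j}{p_k-p_j}+\frac{\alpha_k}{p_k}=0$$ hold for $k=1,\dots,n+1$, the sum being over all $j\in\{1,\dots,n+1\}$ with $j\neq k$. 3. On $\Sigma=\mathbb C\setminus\{0,p_1,\dots,p_{n+1}\}$ let $$G(z)=z\sum_{j=1}^{n+1}\frac{\alpha_j}{z-p_j},\qquad dh=\sum_{j=1}^{n+1}\frac{\alpha_j}{z-p_j}\,dz,$$ fix $z_0\in\Sigma$, and let $$X(z)=\operatorname{Re}\int_{z_0}^z\Big(\tfrac12\big(\tfrac1G-G\big)dh,\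 \tfrac i2\big(\tfrac1G+G\big)dh,\ dh\Big),$$ where removable singularities of the integrands in $\Sigma$ are removed. The set of periods of this integral over closed $C^1$ paths in $\Sigma$ based at $z_0$ is exactly $\mathbb Z\,(0,\pi,0)$. Thus $X$ is well defined as a map $\Sigma\to\mathbb R^3/\mathbb Z(0,\pi,0)$, and it is a smooth immersion with mean curvature zero whose induced metric is complete, that is, a complete, immersed, singly periodic minimal surface with period $(0,\pi,0)$. Let $N=X_u\times X_v/|X_u\times X_v|$ ($z=u+iv$) be its unit normal. (a) The ends at $0$ and at $\infty$ are horizontal annular ends: a neighbourhood of the end is embedded by $X$ in $\mathbb R^3/\mathbb Z(0,\pi,0)$ as the graph of a function over a half-infinite flat annulus $\{(x_1,x_2):\sigma x_1>R\}/\big((x_1,x_2)\sim(x_1,x_2+\pi)\big)$, $\sigma\in\{1,-1\}$, which tends to a constant as $\sigma x_1\to\infty$, with $\sigma x_1\to\infty$ along the end. Moreover $N\to(0,0,-1)$ at $0$ and at $\infty$. (b) For $k=1,\dots,n+1$ the end at $p_k$ is a catenoidal end with neck size $|\alpha_k|$ and vertical limiting normal: some punctured neighbourhood of $p_k$ is embedded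 in $\mathbb R^3$, by a single-valued branch of $X$, onto the graph over $\{r>R\}$, $r=\sqrt{x_1^2+x_2^2}$, of a function $$x_3=-\alpha_k\log r+b+O(1/r),$$ with $r\to\infty$ at $p_k$, and $N\to(0,0,1)$ at $p_k$. In particular the ends at $p_1,\dots,p_n$ all go in one vertical direction, and the end at $p_{n+1}=1$ goes in the opposite one: up at $p_1,\dots,p_n$ and down at $p_{n+1}$ for $\varepsilon=-1$, and the other way round for $\varepsilon=1$. (The two choices of $\varepsilon$ give surfaces that are mirror images of each other in a horizontal plane.) -/

import Mathlib

open scoped Real Topology ContDiff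

noncomputable section

/-! ### The configuration of punctures and the balance equations -/

/-- The polynomial `f_n(z) = ∑_{j=0}^n C(n,j)^2 z^j`. -/
def legendrePoly (n : ℕ) : Polynomial ℂ :=
  ∑ j ∈ Finset.range (n + 1), Polynomial.C ((n.choose j : ℂ) ^ 2) * Polynomial.X ^ j

/-- The catenoidal punctures `p_1, …, p_n` followed by `p_{n+1} = 1`. -/
def catenoidPoints {n : ℕ} (p : Fin n → ℂ) : Fin (n + 1) → ℂ :=
  Fin.snoc (α := fun _ => ℂ) p 1

/-- The residues `α_1 = ⋯ = α_n = ε / n` and `α_{n+1} = -ε`. -/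
def neckSizes (n : ℕ) (ε : ℝ) : Fin (n + 1) → ℝ :=
  Fin.snoc (α := fun _ => ℝ) (fun _ => ε / n) (-ε)

/-- `F_k = 2 ∑_{j ≠ k} α_j / (p_k - p_j) + α_k / p_k`. -/
def balance {m : ℕ} (α : Fin m → ℝ) (p : Fin m → ℂ) (k : Fin m) : ℂ :=
  2 * ∑ j ∈ Finset.univ.erase k, (α j : ℂ) / (p k - p j) + (α k : ℂ) / p k

/-- The domain `Σ = ℂ ∖ {0, p_1, …, p_m}`. -/
def puncturedPlane {m : ℕ} (p : Fin m → ℂ) : Set ℂ :=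
  {z | z ≠ 0 ∧ ∀ j, z ≠ p j}

/-- The coefficient `∑_j α_j / (z - p_j)` of the height differential `dh` with respect to `dz`. -/
def heightCoeff {m : ℕ} (α : Fin m → ℝ) (p : Fin m → ℂ) (z : ℂ) : ℂ :=
  ∑ j, (α j : ℂ) / (z - p j)

/-- The function `G(z) = z ∑_j α_j / (z - p_j)`. -/
def gaussFunction {m : ℕ} (α : Fin m → ℝ) (p : Fin m → ℂ) (z : ℂ) : ℂ :=
  z * heightCoeff α p z

/-! ### The Weierstrass representation -/

/-- The value at `z` of a meromorphic function that is regular at `z` up to a removable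
singularity. The function `dh / G` is of this kind at common zeros of `G` and `dh`. -/
def regularValue (f : ℂ → ℂ) (z : ℂ) : ℂ := Filter.limUnder (𝓝[≠] z) f

/-- The coefficients with respect to `dz` of the three Weierstrass forms
`(1/2) (1/G - G) dh`, `(i/2) (1/G + G) dh`, `dh`, where `dh = η dz`. -/
def weierstrassForm (G η : ℂ → ℂ) (z : ℂ) : Fin 3 → ℂ :=
  ![regularValue (fun w => 1 / 2 * (1 / G w - G w) * η w) z,
    regularValue (fun w => Complex.I / 2 * (1 / G w + G w) * η w) z,
    regularValue η z]

/-- Euclidean three-space. -/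
abbrev E3 : Type := EuclideanSpace ℝ (Fin 3)

/-- `Re ∫_γ Φ dz ∈ ℝ³` for a triple `Φ dz` of complex one-forms. -/
def realPathIntegral (Φ : ℂ → Fin 3 → ℂ) {a b : ℂ} (γ : Path a b) : E3 :=
  WithLp.toLp 2 fun i =>
    (curveIntegral (fun z => Φ z i • ContinuousLinearMap.id ℂ ℂ) γ).re

/-- A continuously differentiable path whose image lies in `S`. -/
def IsC1PathIn (S : Set ℂ) {a b : ℂ} (γ : Path a b) : Prop :=
  (∀ t, γ t ∈ S) ∧ ContDiffOn ℝ 1 γ.extend (Set.Icc 0 1)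

/-- The translation vector `(0, π, 0)`. -/
def periodVector : E3 := !₂[0, π, 0]

/-- The flat three-manifold `ℝ³ / ℤ (0, π, 0)`, with its quotient metric. -/
abbrev E3Quot : Type := E3 ⧸ AddSubgroup.zmultiples periodVector

/-- The projection `ℝ³ → ℝ³ / ℤ (0, π, 0)`. -/
def toQuot (x : E3) : E3Quot := QuotientAddGroup.mk x

/-- `X(z) = Re ∫_{z₀}^z Φ dz` modulo `(0, π, 0)`, independently of the path of integration
in `S`. -/
def IsWeierstrassMap (S : Set ℂ) (Φ : ℂ → Fin 3 → ℂ) (z₀ : ℂ) (X : ℂ → E3Quot) : Prop :=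
  ∀ (z : ℂ) (γ : Path z₀ z), IsC1PathIn S γ → X z = toQuot (realPathIntegral Φ γ)

/-- The periods `Re ∮ Φ dz` over the closed paths in `S` based at `z₀`. -/
def periodSet (S : Set ℂ) (Φ : ℂ → Fin 3 → ℂ) (z₀ : ℂ) : Set E3 :=
  {x | ∃ γ : Path z₀ z₀, IsC1PathIn S γ ∧ realPathIntegral Φ γ = x}

/-- The domain `Σ = ℂ ∖ {0, p_1, …, p_{n+1}}` of the configuration. -/
def configDomain {n : ℕ} (p : Fin n → ℂ) : Set ℂ := puncturedPlane (catenoidPoints p)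

/-- The Weierstrass forms of the configuration: `G = z ∑_j α_j / (z - p_j)` and
`dh = ∑_j α_j / (z - p_j) dz`. -/
def configForm {n : ℕ} (ε : ℝ) (p : Fin n → ℂ) : ℂ → Fin 3 → ℂ :=
  weierstrassForm (gaussFunction (neckSizes n ε) (catenoidPoints p))
    (heightCoeff (neckSizes n ε) (catenoidPoints p))

/-! ### Surfaces in `ℝ³` and in `ℝ³ / ℤ (0, π, 0)` -/

/-- The partial derivative of `Y` in the direction `d`. -/
def partialDeriv (Y : ℂ → E3) (d z : ℂ) : E3 := fderiv ℝ Y z d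

/-- The unit normal `Y_u × Y_v / |Y_u × Y_v|`, where `z = u + i v`. -/
def unitNormal (Y : ℂ → E3) (z : ℂ) : E3 :=
  let m : E3 := WithLp.toLp 2
    (crossProduct (partialDeriv Y 1 z).ofLp (partialDeriv Y Complex.I z).ofLp)
  ‖m‖⁻¹ • m

/-- The mean curvature, through the first fundamental form `E, F, G` and the second
fundamental form `e, f, g`. -/
def meanCurvature (Y : ℂ → E3) (z : ℂ) : ℝ :=
  let Yu := partialDeriv Y 1
  let Yv := partialDeriv Y Complex.I
  let N := unitNormal Y z
  let E := inner ℝ (Yu z) (Yu z)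
  let F := inner ℝ (Yu z) (Yv z)
  let G := inner ℝ (Yv z) (Yv z)
  let e := inner ℝ (partialDeriv Yu 1 z) N
  let f := inner ℝ (partialDeriv Yu Complex.I z) N
  let g := inner ℝ (partialDeriv Yv Complex.I z) N
  (e * G - 2 * f * F + g * E) / (2 * (E * G - F ^ 2))

/-- `Y` is a continuous `ℝ³`-valued branch of `X` on the open set `U`. -/
def IsBranch (X : ℂ → E3Quot) (U : Set ℂ) (Y : ℂ → E3) : Prop :=
  IsOpen U ∧ ContinuousOn Y U ∧ ∀ z ∈ U, toQuot (Y z) = X z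

/-- `X` is a smooth immersion of `S` with mean curvature zero. -/
def IsMinimalImmersion (S : Set ℂ) (X : ℂ → E3Quot) : Prop :=
  ∀ z ∈ S, ∃ (U : Set ℂ) (Y : ℂ → E3), z ∈ U ∧ IsBranch X U Y ∧ ContDiffOn ℝ ∞ Y U ∧
    ∀ w ∈ U, Function.Injective (fderiv ℝ Y w) ∧ meanCurvature Y w = 0

/-- Completeness of the induced metric: the image under `X` of every path in `S` that leaves
every compact subset of `S` has infinite length. -/
def IsCompleteSurface (S : Set ℂ) (X : ℂ → E3Quot) : Prop :=
  ∀ γ : ℝ → ℂ, ContinuousOn γ (Set.Ico 0 1) → Set.MapsTo γ (Set.Ico 0 1) S →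
    (∀ K : Set ℂ, IsCompact K → K ⊆ S → ∀ᶠ t in 𝓝[<] (1 : ℝ), γ t ∉ K) →
    eVariationOn (X ∘ γ) (Set.Ico 0 1) = ⊤

/-- `N` is the unit normal field of `X` on `S`, oriented by the complex coordinate. -/
def IsUnitNormalField (S : Set ℂ) (X : ℂ → E3Quot) (N : ℂ → E3) : Prop :=
  ∀ (U : Set ℂ) (Y : ℂ → E3), U ⊆ S → IsBranch X U Y → ∀ z ∈ U, N z = unitNormal Y z

/-- The distance of `x` from the vertical axis. -/
def horizontalNorm (x : E3) : ℝ := √(x 0 ^ 2 + x 1 ^ 2)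

/-- The end of `X` at the puncture `q` is a catenoidal end with vertical axis and logarithmic
growth `a ≠ 0`: a punctured neighbourhood of `q` is embedded in `ℝ³` by a single-valued branch
of `X`, onto the graph over the exterior of a horizontal disc of a function
`a log r + b + O(1/r)`, with `r → ∞` at `q`. Its neck size is `|a|`; the end goes up if `a > 0`
and down if `a < 0`. -/
def IsCatenoidalEnd (S : Set ℂ) (X : ℂ → E3Quot) (q : ℂ) (a : ℝ) : Prop :=
  a ≠ 0 ∧ ∃ (V : Set ℂ) (Y : ℂ → E3) (u : ℝ → ℝ → ℝ) (R b C : ℝ),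
    V ∈ 𝓝[≠] q ∧ V ⊆ S ∧ IsBranch X V Y ∧ 0 < R ∧
    Set.BijOn Y V {x : E3 | R < horizontalNorm x ∧ x 2 = u (x 0) (x 1)} ∧
    (∀ x : E3, R < horizontalNorm x →
      |u (x 0) (x 1) - (a * Real.log (horizontalNorm x) + b)| ≤ C / horizontalNorm x) ∧
    Filter.Tendsto (fun z => horizontalNorm (Y z)) (𝓝[≠] q) Filter.atTop

/-- The end of `X` along the filter `e` is a horizontal annular end: a neighbourhood of the end
is embedded in `ℝ³ / ℤ (0, π, 0)` by `X` as the graph of a `π`-periodic function over the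
horizontal half-infinite flat annulus `{(s, t) : R < σ s} / (s, t) ∼ (s, t + π)`, `σ = ± 1`,
which tends to a constant height as `σ s → ∞`, and `σ s → ∞` along the end. -/
def IsHorizontalAnnularEnd (S : Set ℂ) (X : ℂ → E3Quot) (e : Filter ℂ) : Prop :=
  ∃ (V : Set ℂ) (u : ℝ → ℝ → ℝ) (σ R c : ℝ),
    IsOpen V ∧ V ∈ e ∧ V ⊆ S ∧ ContinuousOn X V ∧ (σ = 1 ∨ σ = -1) ∧
    (∀ s t, u s (t + π) = u s t) ∧
    Set.BijOn X V (toQuot '' {x : E3 | R < σ * x 0 ∧ x 2 = u (x 0) (x 1)}) ∧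
    (∀ δ > 0, ∃ M, ∀ s t, M < σ * s → |u s t - c| < δ) ∧
    (∀ M, ∀ᶠ z in e, X z ∈ toQuot '' {x : E3 | M < σ * x 0})

end

noncomputable section

/-! ### The polynomial `f_n` -/

section Algebra

open Polynomial

/-! Write `η = ∑ α_j / (z - p_j)`, so that `dh = η dz` and `G = z η`. Then `dh / G = dz / z` has its
only finite pole at `0`, while `G dh = z η² dz` has at each `p_k` a double pole whose residue is
`α_k F_k p_k`. The balance equations therefore say exactly that `z η²` is the derivative of a
rational function, `B = -∑ α_k² p_k / (z - p_k)` (`mul_heightCoeff_sq`,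
`hasDerivAt_polarPrimitive`). So the Weierstrass integral is explicit: `X = (Re ½(log z - B), Re
(i/2)(log z + B), ∑ α_k log |z - p_k|)` up to a constant. Its only multivalued term is `log z`,
whose monodromy `2πi` moves the second coordinate by `π`. This gives the periods (`periodSet_eq`).

The balance equations come from the hypergeometric equation for `f_n`. At a root, `f''/f'` is twice
the sum of the reciprocal differences to the other roots; at `1` the second-order term drops out and
the equation determines `f'/f` (`balance_eq_zero`).

The rest is read off the formula. The three forms have squares of sum zero and no common zero, which
gives a conformal harmonic immersion, hence a minimal one, with stereographic normal `G`. For the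
ends, the horizontal projection is `x₁ + i x₂ = ½(conj (log z) - B)`. At `p_k` the function `B` has
a simple pole, so the projection is the inverse of a local chart, and `x₃ = α_k log |z - p_k| + ⋯`
becomes `-α_k log r + ⋯` (`isCatenoidalEnd_weierstrassMap`). At `0` and `∞` the function `B` is
smooth, and the exponential of twice the conjugate projection is `z` times a nonvanishing smooth
factor; it or its inverse is a chart of the annular end (`isHorizontalAnnularEnd_of_chart`). The
height stays finite at `∞` because `∑ α_k = 0`. Completeness holds because `x₁` or `x₃` is unbounded
along every escape to a puncture. -/

theorem legendrePoly_coeff (n j : ℕ) : (legendrePoly n).coeff j = (n.choose j : ℂ) ^ 2 := by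
  simp only [legendrePoly, finsetSum_coeff, coeff_C_mul, coeff_X_pow, mul_ite, mul_one, mul_zero]
  rw [Finset.sum_ite_eq]
  split_ifs with h
  · rfl
  · rw [Finset.mem_range, not_lt] at h
    simp [Nat.choose_eq_zero_of_lt (by lia : n < j)]

theorem choose_succ_mul_cast (n j : ℕ) :
    (n.choose (j + 1) : ℂ) * (j + 1) = n.choose j * (n - j) := by
  rcases le_or_gt j n with h | h
  · have := Nat.choose_succ_right_eq n j
    rw [← Nat.cast_sub h]
    exact_mod_cast this
  · simp [Nat.choose_eq_zero_of_lt h, Nat.choose_eq_zero_of_lt (h.trans (Nat.lt_succ_self j))]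

/-- The coefficient of `z^j` in the equation is `(j+1)² a_{j+1} - (n-j)² a_j`, and for `a_j =
C(n,j)²` its vanishing is the square of the recursion `(j+1) C(n,j+1) = (n-j) C(n,j)`. -/
theorem legendrePoly_ode (n : ℕ) :
    X * (1 - X) * derivative (derivative (legendrePoly n)) +
      (1 + C (2 * (n : ℂ) - 1) * X) * derivative (legendrePoly n) -
        C ((n : ℂ) ^ 2) * legendrePoly n = 0 := by
  have key : ∀ j : ℕ, ((j : ℂ) + 1) ^ 2 * (n.choose (j + 1) : ℂ) ^ 2 =
      ((n : ℂ) - j) ^ 2 * (n.choose j : ℂ) ^ 2 := fun j => by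
    have := choose_succ_mul_cast n j
    calc _ = ((n.choose (j + 1) : ℂ) * (j + 1)) ^ 2 := by ring
      _ = _ := by rw [this]; ring
  have expand : X * (1 - X) * derivative (derivative (legendrePoly n)) +
      (1 + C (2 * (n : ℂ) - 1) * X) * derivative (legendrePoly n) -
        C ((n : ℂ) ^ 2) * legendrePoly n =
      X * derivative (derivative (legendrePoly n)) -
        X * (X * derivative (derivative (legendrePoly n))) + derivative (legendrePoly n) +
        C (2 * (n : ℂ) - 1) * (X * derivative (legendrePoly n)) -
        C ((n : ℂ) ^ 2) * legendrePoly n := by ring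
  rw [expand]
  ext j
  have k := key j
  -- The term `X²f''` shifts indices by two, so the coefficients of degree `0` and `1` are separate
  -- cases.
  rcases j with _ | _ | j
  · simp only [coeff_sub, coeff_add, coeff_X_mul_zero, coeff_C_mul, coeff_derivative,
      legendrePoly_coeff, coeff_zero]
    push_cast at k ⊢
    linear_combination k
  · simp only [coeff_sub, coeff_add, coeff_X_mul, coeff_X_mul_zero, coeff_C_mul, coeff_derivative,
      legendrePoly_coeff, coeff_zero, zero_add]
    push_cast at k ⊢
    linear_combination k
  · simp only [coeff_sub, coeff_add, coeff_X_mul, coeff_C_mul, coeff_derivative,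
      legendrePoly_coeff, coeff_zero]
    push_cast at k ⊢
    linear_combination k

theorem legendrePoly_ode_eval (n : ℕ) (z : ℂ) :
    z * (1 - z) * (legendrePoly n).derivative.derivative.eval z +
      (1 + (2 * (n : ℂ) - 1) * z) * (legendrePoly n).derivative.eval z -
        (n : ℂ) ^ 2 * (legendrePoly n).eval z = 0 := by
  have := congrArg (eval z) (legendrePoly_ode n)
  simpa using this

theorem legendrePoly_natDegree (n : ℕ) : (legendrePoly n).natDegree = n := by
  refine natDegree_eq_of_le_of_coeff_ne_zero ?_ ?_
  · rw [natDegree_le_iff_coeff_eq_zero]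
    intro j hj
    simp [legendrePoly_coeff, Nat.choose_eq_zero_of_lt hj]
  · simp [legendrePoly_coeff]

theorem legendrePoly_monic (n : ℕ) : (legendrePoly n).Monic := by
  simp [Monic, leadingCoeff, legendrePoly_natDegree, legendrePoly_coeff]

theorem legendrePoly_eval_zero (n : ℕ) : (legendrePoly n).eval 0 = 1 := by
  rw [← coeff_zero_eq_eval_zero, legendrePoly_coeff]; simp

theorem legendrePoly_eval_one (n : ℕ) : (legendrePoly n).eval 1 ≠ 0 := by
  have h : (legendrePoly n).eval 1 = ((∑ j ∈ Finset.range (n + 1), n.choose j ^ 2 : ℕ) : ℂ) := by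
    simp [legendrePoly, eval_finsetSum]
  rw [h, Nat.cast_ne_zero]
  have : n.choose 0 ^ 2 ≤ ∑ j ∈ Finset.range (n + 1), n.choose j ^ 2 :=
    Finset.single_le_sum (f := fun j => n.choose j ^ 2) (fun _ _ => Nat.zero_le _) (by simp)
  simp at this
  lia

/-- The hypergeometric equation forces the roots of `f_n` to be simple. -/
theorem legendrePoly_derivative_eval_ne_zero (n : ℕ) {r : ℂ} (hr : (legendrePoly n).eval r = 0) :
    (legendrePoly n).derivative.eval r ≠ 0 := by
  intro h1
  set f := legendrePoly n with hf
  have hf0 : f ≠ 0 := (legendrePoly_monic n).ne_zero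
  have r0 : r ≠ 0 := by
    rintro rfl; rw [legendrePoly_eval_zero] at hr; exact one_ne_zero hr
  have r1 : r ≠ 1 := by
    rintro rfl; exact legendrePoly_eval_one n hr
  obtain ⟨g, hg, hgr⟩ := exists_eq_pow_rootMultiplicity_mul_and_not_dvd f hf0 r
  have hm : 1 < f.rootMultiplicity r :=
    (one_lt_rootMultiplicity_iff_isRoot hf0).2 ⟨hr, h1⟩
  obtain ⟨k, hk⟩ : ∃ k, f.rootMultiplicity r = k + 2 := ⟨f.rootMultiplicity r - 2, by lia⟩
  rw [hk] at hg
  have hC2 : (C 2 : ℂ[X]) = 2 := rfl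
  have hd : derivative f = (X - C r) ^ (k + 1) * (((k : ℂ[X]) + 2) * g + (X - C r) * derivative g) := by
    rw [hg]; simp [derivative_mul, derivative_pow, hC2]; ring
  have hdd : derivative (derivative f) = (X - C r) ^ k * ((((k : ℂ[X]) + 1) * ((k : ℂ[X]) + 2)) * g +
      (X - C r) * ((2 * ((k : ℂ[X]) + 2)) * derivative g + (X - C r) * derivative (derivative g))) := by
    rw [hd]; simp [derivative_mul, derivative_pow]; ring
  have ode := legendrePoly_ode n
  rw [← hf, hdd, hd, hg] at ode
  -- At a root of multiplicity `k + 2` only the `f''` term contributes at order `(X - r)^k`. Its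
  -- coefficient `r (1 - r) (k + 1) (k + 2) g(r)` would have to vanish.
  have ode' : (X - C r) ^ k * (X * (1 - X) * ((((k : ℂ[X]) + 1) * ((k : ℂ[X]) + 2)) * g +
      (X - C r) * ((2 * ((k : ℂ[X]) + 2)) * derivative g + (X - C r) * derivative (derivative g))) +
      (X - C r) * ((1 + C (2 * (n : ℂ) - 1) * X) *
        (((k : ℂ[X]) + 2) * g + (X - C r) * derivative g)) -
      (X - C r) * ((X - C r) * (C ((n : ℂ) ^ 2) * g))) = 0 := by
    rw [← ode]; ring
  have := (mul_eq_zero.1 ode').resolve_left (pow_ne_zero _ (X_sub_C_ne_zero r))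
  have := congrArg (eval r) this
  simp at this
  rcases this with (h | h) | (h | h) | h
  · exact r0 h
  · exact r1 (sub_eq_zero.1 h).symm
  · exact Nat.cast_add_one_ne_zero k h
  · exact (by exact_mod_cast (by lia : k + 2 ≠ 0) : (k : ℂ) + 2 ≠ 0) h
  · exact hgr (dvd_iff_isRoot.2 h)

/-! ### Roots of `f_n` and the balance equations -/

theorem eval_derivative_prod_X_sub_C {ι : Type*} (s : Finset ι) (p : ι → ℂ) (z : ℂ)
    (hz : ∀ j ∈ s, z ≠ p j) :
    (derivative (∏ j ∈ s, (X - C (p j)))).eval z =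
      (∏ j ∈ s, (X - C (p j))).eval z * ∑ j ∈ s, 1 / (z - p j) := by
  classical
  induction s using Finset.induction_on with
  | empty => simp
  | insert a s ha ih =>
    rw [Finset.prod_insert ha, Finset.sum_insert ha, derivative_mul]
    have h1 : z - p a ≠ 0 := sub_ne_zero.2 (hz a (by simp))
    simp only [eval_add, eval_mul, ih fun j hj => hz j (by simp [hj]), derivative_X_sub_C, eval_one,
      eval_sub, eval_X, eval_C]
    field_simp

theorem legendrePoly_eq_prod {n : ℕ} {p : Fin n → ℂ}
    (hp : (Finset.univ.val.map p : Multiset ℂ) = (legendrePoly n).roots) :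
    legendrePoly n = ∏ j, (X - C (p j)) := by
  have := prod_multiset_X_sub_C_of_monic_of_roots_card_eq (legendrePoly_monic n)
    (by rw [← hp, legendrePoly_natDegree]; simp)
  rw [← this, ← hp, Multiset.map_map]
  rfl

theorem legendrePoly_eval_root {n : ℕ} {p : Fin n → ℂ}
    (hp : (Finset.univ.val.map p : Multiset ℂ) = (legendrePoly n).roots) (k : Fin n) :
    (legendrePoly n).eval (p k) = 0 := by
  rw [legendrePoly_eq_prod hp, eval_prod]
  exact Finset.prod_eq_zero (Finset.mem_univ k) (by simp)

theorem legendrePoly_roots_injective {n : ℕ} {p : Fin n → ℂ}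
    (hp : (Finset.univ.val.map p : Multiset ℂ) = (legendrePoly n).roots) :
    Function.Injective p := by
  have hnd : (legendrePoly n).roots.Nodup := by
    rw [Multiset.nodup_iff_count_le_one]
    intro a
    rw [count_roots]
    by_contra! h
    obtain ⟨h0, h1⟩ := (one_lt_rootMultiplicity_iff_isRoot (legendrePoly_monic n).ne_zero).1 h
    exact legendrePoly_derivative_eval_ne_zero n h0 h1
  rw [← hp] at hnd
  intro i j hij
  exact Multiset.inj_on_of_nodup_map hnd i (Finset.mem_univ i) j (Finset.mem_univ j) hij

theorem legendrePoly_root_ne_zero {n : ℕ} {p : Fin n → ℂ}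
    (hp : (Finset.univ.val.map p : Multiset ℂ) = (legendrePoly n).roots) (k : Fin n) :
    p k ≠ 0 := fun h => by
  have := legendrePoly_eval_root hp k
  rw [h, legendrePoly_eval_zero] at this
  exact one_ne_zero this

theorem legendrePoly_root_ne_one {n : ℕ} {p : Fin n → ℂ}
    (hp : (Finset.univ.val.map p : Multiset ℂ) = (legendrePoly n).roots) (k : Fin n) :
    p k ≠ 1 := fun h => legendrePoly_eval_one n (h ▸ legendrePoly_eval_root hp k)

theorem catenoidPoints_injective {n : ℕ} {p : Fin n → ℂ}
    (hp : (Finset.univ.val.map p : Multiset ℂ) = (legendrePoly n).roots) :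
    Function.Injective (catenoidPoints p) := by
  intro i j
  induction i using Fin.lastCases with
  | last =>
    induction j using Fin.lastCases with
    | last => simp
    | cast j =>
      intro h
      simp only [catenoidPoints, Fin.snoc_last, Fin.snoc_castSucc] at h
      exact absurd h.symm (legendrePoly_root_ne_one hp j)
  | cast i =>
    induction j using Fin.lastCases with
    | last =>
      intro h
      simp only [catenoidPoints, Fin.snoc_last, Fin.snoc_castSucc] at h
      exact absurd h (legendrePoly_root_ne_one hp i)
    | cast j =>
      intro h
      simp only [catenoidPoints, Fin.snoc_castSucc] at h
      rw [legendrePoly_roots_injective hp h]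

theorem catenoidPoints_ne_zero {n : ℕ} {p : Fin n → ℂ}
    (hp : (Finset.univ.val.map p : Multiset ℂ) = (legendrePoly n).roots) (k : Fin (n + 1)) :
    catenoidPoints p k ≠ 0 := by
  induction k using Fin.lastCases with
  | last => simp [catenoidPoints]
  | cast k => simpa [catenoidPoints] using legendrePoly_root_ne_zero hp k

theorem neckSizes_ne_zero {n : ℕ} (hn : 1 ≤ n) {ε : ℝ} (hε : ε ≠ 0) (k : Fin (n + 1)) :
    neckSizes n ε k ≠ 0 := by
  have : (n : ℝ) ≠ 0 := by exact_mod_cast (by lia : n ≠ 0)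
  induction k using Fin.lastCases with
  | last => simpa [neckSizes] using hε
  | cast k => simpa [neckSizes] using ⟨hε, by lia⟩

theorem sum_neckSizes {n : ℕ} (hn : 1 ≤ n) (ε : ℝ) : ∑ k, neckSizes n ε k = 0 := by
  have : (n : ℝ) ≠ 0 := by exact_mod_cast (by lia : n ≠ 0)
  rw [Fin.sum_univ_castSucc]
  simp [neckSizes]
  field_simp
  simp

/-- At `1` the equation reads `2n f'(1) = n² f(1)`, so the logarithmic derivative gives `2 ∑ 1/(1 -
p_j) = n`. At a root, writing `f = (z - p_k) g` gives `f' = g` and `f'' = 2g'`, so the equation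
determines `g'/g = ∑_{j ≠ k} 1/(p_k - p_j)`. -/
theorem balance_eq_zero {n : ℕ} (hn : 1 ≤ n) {p : Fin n → ℂ}
    (hp : (Finset.univ.val.map p : Multiset ℂ) = (legendrePoly n).roots) (ε : ℝ)
    (k : Fin (n + 1)) : balance (neckSizes n ε) (catenoidPoints p) k = 0 := by
  have hn0 : (n : ℂ) ≠ 0 := by exact_mod_cast (by lia : n ≠ 0)
  induction k using Fin.lastCases with
  | last =>
    have hset : (Finset.univ : Finset (Fin (n + 1))).erase (Fin.last n) =
        Finset.univ.map Fin.castSuccEmb := by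
      ext i
      induction i using Fin.lastCases <;> simp [Fin.castSucc_ne_last]
    have h1 := eval_derivative_prod_X_sub_C Finset.univ p 1
      fun j _ => (legendrePoly_root_ne_one hp j).symm
    rw [← legendrePoly_eq_prod hp] at h1
    have ode := legendrePoly_ode_eval n 1
    rw [h1] at ode
    have h2 : (n : ℂ) * (legendrePoly n).eval 1 * (2 * ∑ j, 1 / (1 - p j) - n) = 0 := by
      linear_combination ode
    have h3 := (mul_eq_zero.1 h2).resolve_left (mul_ne_zero hn0 (legendrePoly_eval_one n))
    rw [balance, hset, Finset.sum_map]
    simp only [catenoidPoints, neckSizes, Fin.coe_castSuccEmb, Fin.snoc_last, Fin.snoc_castSucc]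
    have h4 : ∑ x, ((ε / n : ℝ) : ℂ) / (1 - p x) = (ε / n : ℂ) * ∑ j, 1 / (1 - p j) := by
      rw [Finset.mul_sum]
      exact Finset.sum_congr rfl fun j _ => by push_cast; ring
    rw [h4]
    push_cast
    field_simp
    linear_combination (ε : ℂ) * h3
  | cast k =>
    have hset : (Finset.univ : Finset (Fin (n + 1))).erase k.castSucc =
        insert (Fin.last n) ((Finset.univ.erase k).map Fin.castSuccEmb) := by
      ext i
      induction i using Fin.lastCases <;> simp [Fin.castSucc_ne_last, (Fin.castSucc_ne_last _).symm]
    set g : ℂ[X] := ∏ j ∈ Finset.univ.erase k, (X - C (p j)) with hg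
    have hfg : legendrePoly n = (X - C (p k)) * g := by
      rw [legendrePoly_eq_prod hp, hg,
        Finset.mul_prod_erase _ (fun j => (X - C (p j) : ℂ[X])) (Finset.mem_univ k)]
    have hd : (legendrePoly n).derivative.eval (p k) = g.eval (p k) := by
      rw [hfg]; simp [derivative_mul]
    have hdd : (legendrePoly n).derivative.derivative.eval (p k) = 2 * g.derivative.eval (p k) := by
      rw [hfg]; simp [derivative_mul]; ring
    have h1 := eval_derivative_prod_X_sub_C (Finset.univ.erase k) p (p k)
      fun j hj h => (Finset.mem_erase.1 hj).1 (legendrePoly_roots_injective hp h).symm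
    rw [← hg] at h1
    have hg0 : g.eval (p k) ≠ 0 :=
      hd ▸ legendrePoly_derivative_eval_ne_zero n (legendrePoly_eval_root hp k)
    have ode := legendrePoly_ode_eval n (p k)
    rw [hdd, hd, h1, legendrePoly_eval_root hp k] at ode
    set s := ∑ j ∈ Finset.univ.erase k, 1 / (p k - p j) with hs
    have h2 : g.eval (p k) * (2 * p k * (1 - p k) * s + (1 + (2 * n - 1) * p k)) = 0 := by
      linear_combination ode
    have h3 := (mul_eq_zero.1 h2).resolve_left hg0
    rw [balance, hset, Finset.sum_insert (by simp [Fin.castSucc_ne_last]), Finset.sum_map]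
    simp only [catenoidPoints, neckSizes, Fin.coe_castSuccEmb, Fin.snoc_last, Fin.snoc_castSucc]
    have h4 : ∑ x ∈ Finset.univ.erase k, ((ε / n : ℝ) : ℂ) / (p k - p x) = (ε / n : ℂ) * s := by
      rw [hs, Finset.mul_sum]
      exact Finset.sum_congr rfl fun j _ => by push_cast; ring
    rw [h4]
    have hk0 := legendrePoly_root_ne_zero hp k
    have hk1 : p k - 1 ≠ 0 := sub_ne_zero.2 (legendrePoly_root_ne_one hp k)
    push_cast
    field_simp
    linear_combination (-ε : ℂ) * h3

end Algebra

/-! ### Balanced configurations and the primitive of the Weierstrass forms -/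

section Configuration

/-- Distinct nonzero points with nonzero neck sizes of sum zero that satisfy the balance
equations. -/
structure IsBalancedConfig {m : ℕ} (α : Fin m → ℝ) (p : Fin m → ℂ) : Prop where
  pos : 0 < m
  inj : Function.Injective p
  point_ne_zero : ∀ k, p k ≠ 0
  neck_ne_zero : ∀ k, α k ≠ 0
  sum_eq_zero : ∑ k, α k = 0
  balance_eq_zero : ∀ k, balance α p k = 0

variable {m : ℕ} {α : Fin m → ℝ} {p : Fin m → ℂ} {z : ℂ}

/-- The primitive `-∑ α_k² p_k / (z - p_k)` of `z (∑ α_k / (z - p_k))²`. -/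
def polarPrimitive (α : Fin m → ℝ) (p : Fin m → ℂ) (z : ℂ) : ℂ :=
  -∑ k, (α k : ℂ) ^ 2 * p k / (z - p k)

/-- The potential `∑ α_k log |z - p_k|`, the third coordinate of the surface. -/
def heightPotential (α : Fin m → ℝ) (p : Fin m → ℂ) (z : ℂ) : ℝ :=
  ∑ k, α k * Real.log ‖z - p k‖

/-- The multivalued primitive of the Weierstrass forms, as a function of `z` and of a
logarithm `l` of `z`. -/
def weierstrassPrimitive (α : Fin m → ℝ) (p : Fin m → ℂ) (l z : ℂ) : E3 :=
  !₂[(1 / 2 * (l - polarPrimitive α p z)).re, (Complex.I / 2 * (l + polarPrimitive α p z)).re,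
    heightPotential α p z]

/-- The Weierstrass forms with removable singularities removed. -/
def explicitForm (α : Fin m → ℝ) (p : Fin m → ℂ) (z : ℂ) : Fin 3 → ℂ :=
  ![1 / 2 * (1 / z - z * heightCoeff α p z ^ 2),
    Complex.I / 2 * (1 / z + z * heightCoeff α p z ^ 2), heightCoeff α p z]

theorem sub_ne_zero_of_mem_puncturedPlane (hz : z ∈ puncturedPlane p) (k : Fin m) :
    z - p k ≠ 0 := sub_ne_zero.2 (hz.2 k)

theorem isOpen_puncturedPlane (p : Fin m → ℂ) : IsOpen (puncturedPlane p) := by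
  have : puncturedPlane p = {0}ᶜ ∩ ⋂ k, {p k}ᶜ := by
    ext z; simp [puncturedPlane]
  rw [this]
  exact isOpen_compl_singleton.inter (isOpen_iInter_of_finite fun k => isOpen_compl_singleton)

/-- Partial fractions: the simple poles produced by the mixed products sum, by balance, to `-α_k²/(z
- p_k)` at each `p_k`. This cancels the simple pole in `z α_k²/(z - p_k)² = α_k²/(z - p_k) + α_k²
p_k/(z - p_k)²`. -/
theorem mul_heightCoeff_sq (h : IsBalancedConfig α p) (hz : z ∈ puncturedPlane p) :
    z * heightCoeff α p z ^ 2 = ∑ k, (α k : ℂ) ^ 2 * p k / (z - p k) ^ 2 := by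
  have hs := sub_ne_zero_of_mem_puncturedPlane hz
  -- `T k j` is the polar part at `p k` of the mixed product of indices `k` and `j`. Division by
  -- zero makes `T k k = 0`, so the full sum over `j` is the one in the balance equation.
  let T : Fin m → Fin m → ℂ := fun k j =>
    (α k : ℂ) * p k / (z - p k) * ((α j : ℂ) / (p k - p j))
  have hT : ∀ k, ∑ j, T k j = -(α k : ℂ) ^ 2 / (z - p k) / 2 := fun k => by
    have hb := h.balance_eq_zero k
    have h0 := h.point_ne_zero k
    have hsk := hs k
    rw [balance] at hb
    rw [← Finset.mul_sum, ← Finset.sum_erase (a := k) _ (by simp)]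
    have hb2 : ∑ j ∈ Finset.univ.erase k, (α j : ℂ) / (p k - p j) = -((α k : ℂ) / p k) / 2 := by
      linear_combination hb / 2
    rw [hb2]
    field_simp
  have hpair : ∀ k j, z * ((α k : ℂ) / (z - p k) * ((α j : ℂ) / (z - p j))) =
      T k j + T j k + if k = j then z * (α k : ℂ) ^ 2 / (z - p k) ^ 2 else 0 := fun k j => by
    have hsk := hs k
    have hsj := hs j
    split_ifs with hkj
    · subst hkj
      simp only [T, sub_self, div_zero, mul_zero, zero_add]
      field_simp
    · have h1 : p k - p j ≠ 0 := sub_ne_zero.2 (h.inj.ne hkj)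
      have h2 : p j - p k ≠ 0 := sub_ne_zero.2 (h.inj.ne (Ne.symm hkj))
      have h3 : (α j : ℂ) * p j / (z - p j) * ((α k : ℂ) / (p j - p k)) =
          -((α j : ℂ) * p j / (z - p j) * ((α k : ℂ) / (p k - p j))) := by
        rw [← neg_sub (p k) (p j), div_neg, mul_neg]
      simp only [T, h3]
      field_simp
      ring
  have hsum : z * heightCoeff α p z ^ 2 =
      ∑ k, ∑ j, z * ((α k : ℂ) / (z - p k) * ((α j : ℂ) / (z - p j))) := by
    rw [heightCoeff, sq, Finset.sum_mul_sum]
    simp only [Finset.mul_sum]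
  rw [hsum]
  simp only [hpair, Finset.sum_add_distrib]
  rw [Finset.sum_comm (f := fun k j => T j k)]
  simp only [hT, Finset.sum_ite_eq, Finset.mem_univ, if_true, ← Finset.sum_add_distrib]
  refine Finset.sum_congr rfl fun k _ => ?_
  have hsk := hs k
  field_simp
  ring

theorem hasDerivAt_polarPrimitive (h : IsBalancedConfig α p) (hz : z ∈ puncturedPlane p) :
    HasDerivAt (polarPrimitive α p) (z * heightCoeff α p z ^ 2) z := by
  rw [mul_heightCoeff_sq h hz]
  have : ∀ k ∈ (Finset.univ : Finset (Fin m)),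
      HasDerivAt (fun w => (α k : ℂ) ^ 2 * p k / (w - p k))
        (-((α k : ℂ) ^ 2 * p k / (z - p k) ^ 2)) z := fun k _ => by
    have hs := sub_ne_zero_of_mem_puncturedPlane hz k
    refine ((hasDerivAt_const z ((α k : ℂ) ^ 2 * p k)).fun_div
      ((hasDerivAt_id' z).sub_const (p k)) hs).congr_deriv ?_
    ring
  refine (HasDerivAt.fun_sum this).fun_neg.congr_deriv ?_
  simp

/-- The real linear functional `d ↦ Re (c d)`. -/
def reMul (c : ℂ) : ℂ →L[ℝ] ℝ := Complex.reCLM.comp (c • ContinuousLinearMap.id ℝ ℂ)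

@[simp]
theorem reMul_apply (c d : ℂ) : reMul c d = (c * d).re := rfl

theorem HasDerivAt.hasFDerivAt_re {f : ℂ → ℂ} {c : ℂ} (hf : HasDerivAt f c z) :
    HasFDerivAt (fun w => (f w).re) (reMul c) z := by
  have h1 := (hf.hasFDerivAt.restrictScalars ℝ)
  refine (Complex.reCLM.hasFDerivAt.comp z h1).congr_fderiv ?_
  ext d
  simp [mul_comm]

/-- Locally this is the real part of `log (w - q)` or of `log (q - w)`; at least one of the two
avoids the branch cut. -/
theorem hasFDerivAt_log_norm_sub {q : ℂ} (hz : z - q ≠ 0) :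
    HasFDerivAt (fun w : ℂ => Real.log ‖w - q‖) (reMul (1 / (z - q))) z := by
  have h1 : HasDerivAt (fun w => w - q) 1 z := (hasDerivAt_id z).sub_const q
  rcases Complex.mem_slitPlane_or_neg_mem_slitPlane hz with hs | hs
  · convert (h1.clog hs).hasFDerivAt_re using 2
    rw [Complex.log_re]
  · convert (h1.fun_neg.clog hs).hasFDerivAt_re using 2
    · rw [Complex.log_re, norm_neg]
    · rw [neg_div_neg_eq]

theorem hasFDerivAt_heightPotential (hz : z ∈ puncturedPlane p) :
    HasFDerivAt (heightPotential α p) (reMul (heightCoeff α p z)) z := by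
  have : ∀ k ∈ (Finset.univ : Finset (Fin m)),
      HasFDerivAt (fun w => α k * Real.log ‖w - p k‖) (α k • reMul (1 / (z - p k))) z :=
    fun k _ => (hasFDerivAt_log_norm_sub (sub_ne_zero_of_mem_puncturedPlane hz k)).const_mul (α k)
  refine (HasFDerivAt.fun_sum this).congr_fderiv ?_
  ext d
  simp only [heightCoeff, _root_.sum_apply, _root_.smul_apply,
    reMul_apply, Finset.sum_mul, Complex.re_sum, smul_eq_mul]
  refine Finset.sum_congr rfl fun k _ => ?_
  rw [← Complex.re_ofReal_mul]
  ring_nf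

theorem differentiableAt_heightCoeff (hz : z ∈ puncturedPlane p) :
    DifferentiableAt ℂ (heightCoeff α p) z := by
  unfold heightCoeff
  exact DifferentiableAt.fun_sum fun k _ => DifferentiableAt.div (by fun_prop)
    (by fun_prop) (sub_ne_zero_of_mem_puncturedPlane hz k)

theorem differentiableAt_explicitForm (hz : z ∈ puncturedPlane p) (i : Fin 3) :
    DifferentiableAt ℂ (fun w => explicitForm α p w i) z := by
  have h1 := differentiableAt_heightCoeff (α := α) hz
  have h2 : DifferentiableAt ℂ (fun w : ℂ => 1 / w) z :=
    DifferentiableAt.div (by fun_prop) (by fun_prop) hz.1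
  fin_cases i <;> simp only [explicitForm, Fin.zero_eta, Fin.mk_one, Fin.reduceFinMk,
    Matrix.cons_val] <;> fun_prop

/-- The numerator `Q` of `η` over the common denominator takes at a point `p k` the nonzero value
`α_k ∏ (p_k - p_j)`. It is thus a nonzero polynomial, with finitely many roots. -/
theorem eventually_heightCoeff_ne_zero (h : IsBalancedConfig α p) (z : ℂ) :
    ∀ᶠ w in 𝓝[≠] z, heightCoeff α p w ≠ 0 ∨ w ∉ puncturedPlane p := by
  classical
  let Q : Polynomial ℂ := ∑ k, Polynomial.C (α k : ℂ) *
    ∏ j ∈ Finset.univ.erase k, (Polynomial.X - Polynomial.C (p j))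
  have hQeval : ∀ w, Q.eval w = ∑ k, (α k : ℂ) * ∏ j ∈ Finset.univ.erase k, (w - p j) := by
    intro w
    simp [Q, Polynomial.eval_finsetSum, Polynomial.eval_prod]
  have hQ : Q ≠ 0 := by
    intro h0
    let k : Fin m := ⟨0, h.pos⟩
    have h1 := hQeval (p k)
    rw [h0, Polynomial.eval_zero, Finset.sum_eq_single k] at h1
    · refine mul_ne_zero (Complex.ofReal_ne_zero.2 (h.neck_ne_zero k))
        (Finset.prod_ne_zero_iff.2 fun j hj => ?_) h1.symm
      exact sub_ne_zero.2 (h.inj.ne (Finset.mem_erase.1 hj).1.symm)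
    · intro j _ hj
      rw [Finset.prod_eq_zero (Finset.mem_erase.2 ⟨hj.symm, Finset.mem_univ k⟩) (sub_self _),
        mul_zero]
    · simp
  have hfin : ((Q.roots.toFinset : Set ℂ) \ {z}).Finite := (Finset.finite_toSet _).sdiff
  have hev : ∀ᶠ w in 𝓝[≠] z, w ∉ (Q.roots.toFinset : Set ℂ) \ {z} :=
    nhdsWithin_le_nhds (hfin.isClosed.isOpen_compl.mem_nhds (by simp))
  filter_upwards [hev, self_mem_nhdsWithin] with w hw hwz
  by_contra! hcon
  obtain ⟨h1, h2⟩ := hcon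
  apply hw
  refine ⟨?_, hwz⟩
  simp only [Finset.mem_coe, Multiset.mem_toFinset, Polynomial.mem_roots hQ, Polynomial.IsRoot.def]
  have : Q.eval w = heightCoeff α p w * ∏ j, (w - p j) := by
    rw [hQeval, heightCoeff, Finset.sum_mul]
    refine Finset.sum_congr rfl fun k _ => ?_
    rw [← Finset.mul_prod_erase _ (fun j => w - p j) (Finset.mem_univ k)]
    have := sub_ne_zero_of_mem_puncturedPlane h2 k
    field_simp
  rw [this, h1, zero_mul]

/-- Away from the isolated zeros of `η` one has `η / G = 1 / z`. At such a zero the literal quotient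
is `0` in Lean, so the value has to be recovered as a limit over a punctured neighbourhood. -/
theorem weierstrassForm_eq (h : IsBalancedConfig α p) (hz : z ∈ puncturedPlane p) :
    weierstrassForm (gaussFunction α p) (heightCoeff α p) z = explicitForm α p z := by
  have hev : ∀ᶠ w in 𝓝[≠] z, heightCoeff α p w ≠ 0 ∧ w ≠ 0 := by
    filter_upwards [eventually_heightCoeff_ne_zero h z,
      nhdsWithin_le_nhds ((isOpen_puncturedPlane p).mem_nhds hz)] with w hw hwS
    exact ⟨hw.resolve_right (not_not.2 hwS), hwS.1⟩
  have key : ∀ (f : ℂ → ℂ) (i : Fin 3),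
      (∀ w, heightCoeff α p w ≠ 0 → w ≠ 0 → f w = explicitForm α p w i) →
      regularValue f z = explicitForm α p z i := fun f i hf => by
    refine Filter.Tendsto.limUnder_eq (Filter.Tendsto.congr' ?_
      (((differentiableAt_explicitForm hz i).continuousAt.tendsto).mono_left nhdsWithin_le_nhds))
    filter_upwards [hev] with w hw
    exact (hf w hw.1 hw.2).symm
  funext i
  fin_cases i
  · refine key _ 0 fun w h1 h2 => ?_
    simp only [explicitForm, gaussFunction, Matrix.cons_val]
    field_simp
  · refine key _ 1 fun w h1 h2 => ?_
    simp only [explicitForm, gaussFunction, Matrix.cons_val]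
    field_simp
  · exact key _ 2 fun w h1 h2 => rfl

/-- Adding `2πik` to the logarithm changes `½ l` by an imaginary number and `(i/2) l` by `-kπ`. -/
theorem weierstrassPrimitive_add_period (k : ℤ) (l z : ℂ) :
    weierstrassPrimitive α p (l + k * (2 * π * Complex.I)) z =
      weierstrassPrimitive α p l z - k • periodVector := by
  ext i
  fin_cases i
  · simp [weierstrassPrimitive, periodVector]
  · simp [weierstrassPrimitive, periodVector]
    ring
  · simp [weierstrassPrimitive, periodVector]

theorem weierstrassPrimitive_sub_mem {l l' : ℂ} (h : Complex.exp l = Complex.exp l') (z : ℂ) :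
    weierstrassPrimitive α p l z - weierstrassPrimitive α p l' z ∈
      AddSubgroup.zmultiples periodVector := by
  obtain ⟨k, rfl⟩ := Complex.exp_eq_exp_iff_exists_int.1 h
  rw [weierstrassPrimitive_add_period, AddSubgroup.mem_zmultiples_iff]
  exact ⟨-k, by simp⟩

end Configuration

/-! ### Integration along paths -/

section Paths

open Set Complex

variable {m : ℕ} {α : Fin m → ℝ} {p : Fin m → ℂ} {a b : ℂ}

theorem IsC1PathIn.extend_mem {S : Set ℂ} {γ : Path a b} (hγ : IsC1PathIn S γ) (t : ℝ) :
    γ.extend t ∈ S := by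
  exact hγ.1 _

theorem IsC1PathIn.hasDerivWithinAt {S : Set ℂ} {γ : Path a b} (hγ : IsC1PathIn S γ) {t : ℝ}
    (ht : t ∈ Icc (0 : ℝ) 1) :
    HasDerivWithinAt γ.extend (derivWithin γ.extend (Icc 0 1) t) (Icc 0 1) t :=
  (hγ.2.differentiableOn one_ne_zero t ht).hasDerivWithinAt

theorem IsC1PathIn.continuousOn_deriv {S : Set ℂ} {γ : Path a b} (hγ : IsC1PathIn S γ) :
    ContinuousOn (derivWithin γ.extend (Icc 0 1)) (Icc 0 1) :=
  hγ.2.continuousOn_derivWithin (uniqueDiffOn_Icc zero_lt_one) le_rfl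

/-- A continuously differentiable path that avoids the origin lifts through the exponential
function. -/
theorem exists_log_lift {S : Set ℂ} (hS : ∀ z ∈ S, z ≠ 0) {γ : Path a b} (hγ : IsC1PathIn S γ) :
    ∃ L : ℝ → ℂ, (∀ t ∈ Icc (0 : ℝ) 1,
        HasDerivWithinAt L (derivWithin γ.extend (Icc 0 1) t / γ.extend t) (Icc 0 1) t) ∧
      L 0 = log a ∧ ∀ t ∈ Icc (0 : ℝ) 1, exp (L t) = γ.extend t := by
  have hne : ∀ t, γ.extend t ≠ 0 := fun t => hS _ (hγ.extend_mem t)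
  let q : ℝ → ℂ := fun t => derivWithin γ.extend (Icc 0 1) t / γ.extend t
  have hq : ContinuousOn q (Icc 0 1) :=
    hγ.continuousOn_deriv.div γ.continuous_extend.continuousOn fun t _ => hne t
  -- Extending the integrand continuously to `ℝ` makes its integral differentiable at the endpoints
  -- too.
  let g : ℝ → ℂ := IccExtend (zero_le_one' ℝ) ((Icc (0 : ℝ) 1).domRestrict q)
  have hg : Continuous g := (continuousOn_iff_continuous_domRestrict.1 hq).Icc_extend'
  have hgq : ∀ t ∈ Icc (0 : ℝ) 1, g t = q t := fun t ht => by
    simp only [g, IccExtend_of_mem _ _ ht, domRestrict_apply]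
  let L : ℝ → ℂ := fun t => log a + ∫ s in (0 : ℝ)..t, g s
  have hL : ∀ t, HasDerivAt L (g t) t := fun t =>
    (hg.integral_hasStrictDerivAt 0 t).hasDerivAt.const_add _
  have hL' : ∀ t ∈ Icc (0 : ℝ) 1, HasDerivWithinAt L (q t) (Icc 0 1) t := fun t ht =>
    hgq t ht ▸ (hL t).hasDerivWithinAt
  have ha : a ≠ 0 := by simpa using hne 0
  refine ⟨L, hL', by simp [L], ?_⟩
  -- The quotient of the path by `exp L` has derivative zero.
  have hconst : ∀ t ∈ Icc (0 : ℝ) 1, exp (-L t) * γ.extend t = exp (-L 0) * γ.extend 0 := by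
    refine constant_of_derivWithin_zero (f := fun t => exp (-L t) * γ.extend t) ?_ ?_
    · intro t ht
      exact (((hL' t ht).neg.cexp).mul (hγ.hasDerivWithinAt ht)).differentiableWithinAt
    · intro t ht
      have ht' : t ∈ Icc (0 : ℝ) 1 := ⟨ht.1, ht.2.le⟩
      have hd := ((hL' t ht').fun_neg.cexp).fun_mul (hγ.hasDerivWithinAt ht')
      rw [hd.derivWithin (uniqueDiffOn_Icc zero_lt_one t ht')]
      have := hne t
      simp only [q]
      field_simp
      ring
  intro t ht
  have h1 := hconst t ht
  have h2 : exp (-L 0) * γ.extend 0 = 1 := by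
    simp [L, Complex.exp_neg, exp_log ha, ha]
  rw [h2, Complex.exp_neg] at h1
  field_simp at h1
  exact h1.symm

theorem hasDerivWithinAt_weierstrassPrimitive (h : IsBalancedConfig α p) {L c : ℝ → ℂ}
    {c' : ℂ} {s : Set ℝ} {t : ℝ} (hc : HasDerivWithinAt c c' s t) (hS : c t ∈ puncturedPlane p)
    (hL : HasDerivWithinAt L (c' / c t) s t) (i : Fin 3) :
    HasDerivWithinAt (fun t => weierstrassPrimitive α p (L t) (c t) i)
      (explicitForm α p (c t) i * c').re s t := by
  have hB : HasDerivWithinAt (fun t => polarPrimitive α p (c t))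
      (c t * heightCoeff α p (c t) ^ 2 * c') s t :=
    (hasDerivAt_polarPrimitive h hS).comp_hasDerivWithinAt t hc
  fin_cases i
  · refine (Complex.reCLM.hasFDerivAt.comp_hasDerivWithinAt t
      ((hL.fun_sub hB).const_mul (1 / 2 : ℂ))).congr_deriv ?_
    simp only [explicitForm, Fin.zero_eta, Matrix.cons_val, Complex.reCLM_apply]
    congr 1
    ring
  · refine (Complex.reCLM.hasFDerivAt.comp_hasDerivWithinAt t
      ((hL.fun_add hB).const_mul (I / 2 : ℂ))).congr_deriv ?_
    simp only [explicitForm, Fin.mk_one, Matrix.cons_val, Complex.reCLM_apply]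
    congr 1
    ring
  · exact (hasFDerivAt_heightPotential hS).comp_hasDerivWithinAt t hc

/-- The fundamental theorem of calculus applies along the path. The logarithm is carried as a lift
`L` in the parameter, so no branch in the plane is needed. -/
theorem realPathIntegral_eq_sub (h : IsBalancedConfig α p) {γ : Path a b}
    (hγ : IsC1PathIn (puncturedPlane p) γ) {L : ℝ → ℂ}
    (hL : ∀ t ∈ Icc (0 : ℝ) 1,
      HasDerivWithinAt L (derivWithin γ.extend (Icc 0 1) t / γ.extend t) (Icc 0 1) t) :
    realPathIntegral (weierstrassForm (gaussFunction α p) (heightCoeff α p)) γ =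
      weierstrassPrimitive α p (L 1) b - weierstrassPrimitive α p (L 0) a := by
  ext i
  have hcont : ContinuousOn (fun t => explicitForm α p (γ.extend t) i *
      derivWithin γ.extend (Icc 0 1) t) (Icc 0 1) := by
    refine ContinuousOn.mul (fun t _ => ?_) hγ.continuousOn_deriv
    exact ((differentiableAt_explicitForm (hγ.extend_mem t) i).continuousAt.comp
      (f := γ.extend) γ.continuous_extend.continuousAt).continuousWithinAt
  have hint : IntervalIntegrable (fun t => explicitForm α p (γ.extend t) i *
      derivWithin γ.extend (Icc 0 1) t) MeasureTheory.volume 0 1 :=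
    hcont.intervalIntegrable_of_Icc zero_le_one
  have hd : ∀ t ∈ Icc (0 : ℝ) 1, HasDerivWithinAt
      (fun t => weierstrassPrimitive α p (L t) (γ.extend t) i)
      (explicitForm α p (γ.extend t) i * derivWithin γ.extend (Icc 0 1) t).re (Icc 0 1) t :=
    fun t ht => hasDerivWithinAt_weierstrassPrimitive h (hγ.hasDerivWithinAt ht)
      (hγ.extend_mem t) (hL t ht) i
  have hftc := intervalIntegral.integral_eq_sub_of_hasDeriv_right_of_le zero_le_one
    (fun t ht => (hd t ht).continuousWithinAt)
    (fun t ht => ((hd t ⟨ht.1.le, ht.2.le⟩).hasDerivAt (Icc_mem_nhds ht.1 ht.2)).hasDerivWithinAt)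
    ((Complex.continuous_re.comp_continuousOn hcont).intervalIntegrable_of_Icc zero_le_one)
  have hre : (∫ t in (0 : ℝ)..1, explicitForm α p (γ.extend t) i *
      derivWithin γ.extend (Icc 0 1) t).re = ∫ t in (0 : ℝ)..1,
        (explicitForm α p (γ.extend t) i * derivWithin γ.extend (Icc 0 1) t).re :=
    (Complex.reCLM.intervalIntegral_comp_comm hint).symm
  have hcurve : curveIntegral (fun z => weierstrassForm (gaussFunction α p) (heightCoeff α p) z i •
      ContinuousLinearMap.id ℂ ℂ) γ = ∫ t in (0 : ℝ)..1, explicitForm α p (γ.extend t) i *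
        derivWithin γ.extend (Icc 0 1) t := by
    rw [curveIntegral_def]
    refine intervalIntegral.integral_congr fun t _ => ?_
    simp only [curveIntegralFun_def, weierstrassForm_eq h (hγ.extend_mem t), smul_apply,
      ContinuousLinearMap.id_apply, smul_eq_mul]
  simp only [realPathIntegral, hcurve, hre]
  simpa using hftc

/-- In the logarithmic coordinate the loop winding `k` times is a vertical segment, bent sideways by
`s t (1 - t)`. Meeting a lift of some `p j` fixes `t` through the imaginary part and then `s`
through the real part, so only countably many `s` are bad. -/
theorem exists_avoiding_loop {z₀ : ℂ} (hz₀ : z₀ ∈ puncturedPlane p) {k : ℤ} (hk : k ≠ 0) :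
    ∃ s : ℝ, ∀ t ∈ Icc (0 : ℝ) 1,
      exp (log z₀ + k * (2 * π * I) * t + s * t * (1 - t)) ∈ puncturedPlane p := by
  -- `τ j N` is the only time at which the height of `log (p j) + 2πiN` is reached.
  let τ : Fin m → ℤ → ℝ := fun j N =>
    ((log (p j)).im - (log z₀).im + 2 * π * N) / (2 * π * k)
  let bad : Set ℝ := ⋃ j : Fin m, range fun N : ℤ =>
    ((log (p j)).re - (log z₀).re) / (τ j N * (1 - τ j N))
  have hbad : bad.Countable := countable_iUnion fun j => countable_range _
  obtain ⟨s, hs⟩ := (hbad.dense_compl ℝ).nonempty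
  refine ⟨s, fun t ht => ⟨exp_ne_zero _, fun j hj => ?_⟩⟩
  rcases eq_or_lt_of_le ht.1 with rfl | ht0
  · simp [exp_log hz₀.1] at hj
    exact hz₀.2 j hj
  rcases eq_or_lt_of_le ht.2 with rfl | ht1
  · simp [exp_log hz₀.1, exp_add, exp_int_mul_two_pi_mul_I] at hj
    exact hz₀.2 j hj
  have hpj : p j ≠ 0 := hj ▸ exp_ne_zero _
  rw [← exp_log hpj, exp_eq_exp_iff_exists_int] at hj
  obtain ⟨N, hN⟩ := hj
  have him := congrArg Complex.im hN
  have hre := congrArg Complex.re hN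
  simp at him hre
  have hk' : (k : ℝ) ≠ 0 := by exact_mod_cast hk
  have hpi := Real.pi_ne_zero
  have ht' : τ j N = t := by
    simp only [τ]
    field_simp
    linear_combination -him
  refine hs (mem_iUnion.2 ⟨j, N, ?_⟩)
  have h1 : (1 : ℝ) - t ≠ 0 := by linarith
  simp only [ht']
  field_simp
  linear_combination -hre

theorem periodSet_eq (h : IsBalancedConfig α p) {z₀ : ℂ} (hz₀ : z₀ ∈ puncturedPlane p) :
    periodSet (puncturedPlane p) (weierstrassForm (gaussFunction α p) (heightCoeff α p)) z₀ =
      AddSubgroup.zmultiples periodVector := by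
  apply Subset.antisymm
  · rintro x ⟨γ, hγ, rfl⟩
    obtain ⟨L, hL, -, hexp⟩ := exists_log_lift (fun z hz => hz.1) hγ
    rw [realPathIntegral_eq_sub h hγ hL]
    apply weierstrassPrimitive_sub_mem
    rw [hexp 0 (by simp), hexp 1 (by simp)]
    simp
  · rintro x hx
    obtain ⟨k, rfl⟩ := AddSubgroup.mem_zmultiples_iff.1 hx
    by_cases hk : k = 0
    · refine ⟨Path.refl z₀, ⟨fun _ => hz₀, ?_⟩, ?_⟩
      · simp only [Path.refl_extend]
        exact contDiffOn_const
      · subst hk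
        ext i
        simp [realPathIntegral]
    -- The sign is reversed because one positive turn about `0` contributes `-periodVector`.
    obtain ⟨s, hs⟩ := exists_avoiding_loop hz₀ (neg_ne_zero.2 hk)
    let L : ℝ → ℂ := fun t => log z₀ + (-k : ℤ) * (2 * π * I) * t + s * t * (1 - t)
    have hLd : ContDiff ℝ 1 L := by
      have hof : ContDiff ℝ 1 (fun t : ℝ => (t : ℂ)) := ofRealCLM.contDiff
      simp only [L]
      fun_prop
    have hLc : Continuous fun t => exp (L t) := continuous_exp.comp hLd.continuous
    let γ : Path z₀ z₀ :=
      { toFun := fun t => exp (L t)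
        continuous_toFun := hLc.comp continuous_subtype_val
        source' := by simp [L, exp_log hz₀.1]
        target' := by
          have := exp_int_mul_two_pi_mul_I (-k)
          simp only [Icc.coe_one, L, ofReal_one, mul_one, sub_self, mul_zero, add_zero]
          rw [exp_add, this, exp_log hz₀.1, mul_one] }
    have hγe : ∀ t ∈ Icc (0 : ℝ) 1, γ.extend t = exp (L t) := fun t ht => by
      rw [Path.extend_apply _ ht]; rfl
    have hγ : IsC1PathIn (puncturedPlane p) γ := by
      refine ⟨fun t => hs t t.2, ?_⟩
      exact (hLd.cexp.contDiffOn).congr hγe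
    have hL : ∀ t ∈ Icc (0 : ℝ) 1,
        HasDerivWithinAt L (derivWithin γ.extend (Icc 0 1) t / γ.extend t) (Icc 0 1) t := by
      intro t ht
      have h1 : HasDerivAt L (deriv L t) t := (hLd.differentiable one_ne_zero t).hasDerivAt
      have h2 : HasDerivWithinAt γ.extend (exp (L t) * deriv L t) (Icc 0 1) t :=
        h1.cexp.hasDerivWithinAt.congr hγe (hγe t ht)
      rw [h2.derivWithin (uniqueDiffOn_Icc zero_lt_one t ht), hγe t ht,
        mul_div_cancel_left₀ _ (exp_ne_zero _)]
      exact h1.hasDerivWithinAt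
    refine ⟨γ, hγ, ?_⟩
    rw [realPathIntegral_eq_sub h hγ hL]
    have h1 : L 1 = L 0 + (-k : ℤ) * (2 * π * I) := by simp [L]
    rw [h1, weierstrassPrimitive_add_period]
    simp

/-- The Weierstrass map `z ↦ X(z)`, through the primitive of the Weierstrass forms. -/
def weierstrassMap (α : Fin m → ℝ) (p : Fin m → ℂ) (z₀ z : ℂ) : E3Quot :=
  toQuot (weierstrassPrimitive α p (log z) z - weierstrassPrimitive α p (log z₀) z₀)

theorem toQuot_eq_iff {x y : E3} :
    toQuot x = toQuot y ↔ x - y ∈ AddSubgroup.zmultiples periodVector := by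
  rw [toQuot, toQuot, QuotientAddGroup.eq, ← neg_mem_iff]
  simp [sub_eq_add_neg, add_comm]

theorem weierstrassMap_eq {z z₀ l : ℂ} (hl : exp l = z) :
    weierstrassMap α p z₀ z =
      toQuot (weierstrassPrimitive α p l z - weierstrassPrimitive α p (log z₀) z₀) := by
  rw [weierstrassMap, toQuot_eq_iff, sub_sub_sub_cancel_right]
  apply weierstrassPrimitive_sub_mem
  rw [exp_log (hl ▸ exp_ne_zero l), hl]

theorem isWeierstrassMap_weierstrassMap (h : IsBalancedConfig α p) (z₀ : ℂ) :
    IsWeierstrassMap (puncturedPlane p) (weierstrassForm (gaussFunction α p) (heightCoeff α p))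
      z₀ (weierstrassMap α p z₀) := by
  intro z γ hγ
  obtain ⟨L, hL, hL0, hexp⟩ := exists_log_lift (fun z hz => hz.1) hγ
  rw [realPathIntegral_eq_sub h hγ hL, hL0]
  exact weierstrassMap_eq (by rw [hexp 1 (by simp)]; simp)

end Paths

/-! ### Branches of the Weierstrass map, mean curvature and unit normal -/

section Branches

open Set Complex

variable {m : ℕ} {α : Fin m → ℝ} {p : Fin m → ℂ} {z z₀ c : ℂ}

/-- The branch of the logarithm near `c` that agrees with the principal one at `c`. -/
def localLog (c z : ℂ) : ℂ := log (z / c) + log c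

theorem exp_localLog (hc : c ≠ 0) (hz : z ≠ 0) : exp (localLog c z) = z := by
  rw [localLog, exp_add, exp_log (div_ne_zero hz hc), exp_log hc, div_mul_cancel₀ _ hc]

theorem hasDerivAt_localLog (hz : z / c ∈ slitPlane) : HasDerivAt (localLog c) (1 / z) z := by
  have h0 : z / c ≠ 0 := slitPlane_ne_zero hz
  have hz0 : z ≠ 0 := fun h => h0 (by simp [h])
  have hc0 : c ≠ 0 := fun h => h0 (by simp [h])
  refine ((((hasDerivAt_id' z).div_const c).clog hz).add_const (log c)).congr_deriv ?_
  field_simp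

theorem isOpen_div_mem_slitPlane (c : ℂ) : IsOpen {z : ℂ | z / c ∈ slitPlane} :=
  isOpen_slitPlane.preimage (continuous_id.div_const c)

theorem div_self_mem_slitPlane (hc : c ≠ 0) : c / c ∈ slitPlane := by
  rw [div_self hc]; exact one_mem_slitPlane

/-- The branch of the Weierstrass map near `c`. -/
def localBranch (α : Fin m → ℝ) (p : Fin m → ℂ) (z₀ c z : ℂ) : E3 :=
  weierstrassPrimitive α p (localLog c z) z - weierstrassPrimitive α p (log z₀) z₀

theorem toQuot_localBranch (hc : c ≠ 0) (hz : z ≠ 0) :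
    toQuot (localBranch α p z₀ c z) = weierstrassMap α p z₀ z :=
  (weierstrassMap_eq (exp_localLog hc hz)).symm

/-- The real linear map `d ↦ Re (w d)`. -/
def formDeriv (w : Fin 3 → ℂ) : ℂ →L[ℝ] E3 :=
  (EuclideanSpace.equiv (Fin 3) ℝ).symm.toContinuousLinearMap.comp
    (ContinuousLinearMap.pi fun i => reMul (w i))

@[simp]
theorem formDeriv_apply (w : Fin 3 → ℂ) (d : ℂ) (i : Fin 3) :
    formDeriv w d i = (w i * d).re := rfl

theorem hasFDerivAt_formDeriv {f : ℂ → E3} {w : Fin 3 → ℂ}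
    (hf : ∀ i, HasFDerivAt (fun x => f x i) (reMul (w i)) z) : HasFDerivAt f (formDeriv w) z := by
  rw [← hasFDerivWithinAt_univ, hasFDerivWithinAt_euclidean]
  exact fun i => (hf i).hasFDerivWithinAt

theorem hasFDerivAt_localBranch (h : IsBalancedConfig α p) (hz : z ∈ puncturedPlane p)
    (hc : z / c ∈ slitPlane) :
    HasFDerivAt (localBranch α p z₀ c) (formDeriv (explicitForm α p z)) z := by
  have hL := hasDerivAt_localLog hc
  have hB := hasDerivAt_polarPrimitive h hz
  refine HasFDerivAt.sub_const _ (hasFDerivAt_formDeriv fun i => ?_)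
  fin_cases i
  · exact ((hL.fun_sub hB).const_mul (1 / 2 : ℂ)).hasFDerivAt_re
  · exact ((hL.fun_add hB).const_mul (I / 2 : ℂ)).hasFDerivAt_re
  · exact hasFDerivAt_heightPotential hz

theorem contDiffAt_localLog (hc : z / c ∈ slitPlane) : ContDiffAt ℝ ∞ (localLog c) z := by
  refine ContDiffAt.add ?_ contDiffAt_const
  exact ((contDiffAt_log (n := ∞) hc).restrict_scalars ℝ).comp z (contDiffAt_id.div_const c)

theorem contDiffAt_localBranch (hz : z ∈ puncturedPlane p) (hc : z / c ∈ slitPlane) :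
    ContDiffAt ℝ ∞ (localBranch α p z₀ c) z := by
  have hL : ContDiffAt ℝ ∞ (localLog c) z := contDiffAt_localLog hc
  have hB : ContDiffAt ℝ ∞ (polarPrimitive α p) z := by
    unfold polarPrimitive
    refine (ContDiffAt.sum fun k _ => ?_).neg
    simp only [div_eq_mul_inv]
    exact contDiffAt_const.mul ((contDiffAt_id.sub contDiffAt_const).inv
      (sub_ne_zero_of_mem_puncturedPlane hz k))
  refine ContDiffAt.sub ?_ contDiffAt_const
  refine contDiffAt_euclidean.2 fun i => ?_
  fin_cases i
  · exact reCLM.contDiff.contDiffAt.comp z (contDiffAt_const.mul (hL.sub hB))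
  · exact reCLM.contDiff.contDiffAt.comp z (contDiffAt_const.mul (hL.add hB))
  · change ContDiffAt ℝ ∞ (heightPotential α p) z
    unfold heightPotential
    refine ContDiffAt.sum fun k _ => contDiffAt_const.mul ?_
    have hs := sub_ne_zero_of_mem_puncturedPlane hz k
    exact ((contDiffAt_id.sub contDiffAt_const).norm ℝ hs).log (norm_ne_zero_iff.2 hs)

theorem norm_zsmul_periodVector (k : ℤ) : ‖k • periodVector‖ = |(k : ℝ)| * π := by
  have h1 : ‖periodVector‖ = π := by
    simp [periodVector, EuclideanSpace.norm_eq, Fin.sum_univ_three, Real.sqrt_sq Real.pi_pos.le]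
  rw [← Int.cast_smul_eq_zsmul ℝ, norm_smul, h1, Real.norm_eq_abs]

/-- Continuous branches of the same map differ locally by a constant. -/
theorem IsBranch.eventuallyEq_localBranch (h : IsBalancedConfig α p) {U : Set ℂ} {Y : ℂ → E3}
    (hY : IsBranch (weierstrassMap α p z₀) U Y) (hU : U ⊆ puncturedPlane p) (hz : z ∈ U) :
    ∃ v, Y =ᶠ[𝓝 z] fun w => localBranch α p z₀ z w + v := by
  obtain ⟨hUo, hYc, hYX⟩ := hY
  have hz0 := (hU hz).1
  let D : ℂ → E3 := fun w => Y w - localBranch α p z₀ z w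
  have hD : ContinuousAt D z :=
    (hYc.continuousAt (hUo.mem_nhds hz)).sub
      (hasFDerivAt_localBranch h (hU hz) (div_self_mem_slitPlane hz0)).continuousAt
  have hmem : ∀ w ∈ U, D w ∈ AddSubgroup.zmultiples periodVector := fun w hw => by
    rw [← toQuot_eq_iff, hYX w hw, toQuot_localBranch hz0 (hU hw).1]
  -- The difference of the branches takes values in multiples of a vector of length `π`, so it is
  -- constant wherever it varies by less than `π`.
  have hball := hD (Metric.ball_mem_nhds (D z) Real.pi_pos)
  refine ⟨D z, ?_⟩
  filter_upwards [hball, hUo.mem_nhds hz] with w hw hwU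
  obtain ⟨k, hk⟩ := AddSubgroup.mem_zmultiples_iff.1 (sub_mem (hmem w hwU) (hmem z hz))
  have hlt : ‖D w - D z‖ < π := by simpa [dist_eq_norm] using hw
  rw [← hk, norm_zsmul_periodVector] at hlt
  have hk1 : |(k : ℝ)| < 1 := by
    by_contra! hcon
    nlinarith [Real.pi_pos]
  have hk0 : k = 0 := by
    rw [← Int.cast_abs] at hk1
    exact Int.abs_lt_one_iff.1 (by exact_mod_cast hk1)
  rw [hk0, zero_smul, eq_comm, sub_eq_zero] at hk
  rw [← hk]
  simp [D]

theorem IsBranch.hasFDerivAt (h : IsBalancedConfig α p) {U : Set ℂ} {Y : ℂ → E3}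
    (hY : IsBranch (weierstrassMap α p z₀) U Y) (hU : U ⊆ puncturedPlane p) (hz : z ∈ U) :
    HasFDerivAt Y (formDeriv (explicitForm α p z)) z := by
  obtain ⟨v, hv⟩ := hY.eventuallyEq_localBranch h hU hz
  exact ((hasFDerivAt_localBranch h (hU hz)
    (div_self_mem_slitPlane (hU hz).1)).add_const v).congr_of_eventuallyEq hv

/-- This is the null condition behind conformality: its real part gives `|X_u| = |X_v|`, its
imaginary part `X_u ⊥ X_v`. -/
theorem explicitForm_sum_sq (hz : z ≠ 0) :
    explicitForm α p z 0 ^ 2 + explicitForm α p z 1 ^ 2 + explicitForm α p z 2 ^ 2 = 0 := by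
  simp only [explicitForm, Matrix.cons_val]
  have hI := I_sq
  field_simp
  rw [hI]
  ring

theorem explicitForm_conformal (hz : z ≠ 0) :
    (∑ i, (explicitForm α p z i).re ^ 2 = ∑ i, (explicitForm α p z i).im ^ 2) ∧
      ∑ i, (explicitForm α p z i).re * (explicitForm α p z i).im = 0 := by
  have h := explicitForm_sum_sq (α := α) (p := p) hz
  have hre := congrArg Complex.re h
  have him := congrArg Complex.im h
  simp only [sq, add_re, add_im, mul_re, mul_im, zero_re, zero_im] at hre him
  rw [Fin.sum_univ_three, Fin.sum_univ_three, Fin.sum_univ_three]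
  constructor
  · linear_combination hre
  · linear_combination him / 2

/-- If every `φ_i d` is imaginary, the null condition becomes a vanishing sum of real squares, so
every `φ_i d` is zero. But `φ_0 - i φ_1 = 1/z` never vanishes. -/
theorem injective_formDeriv_explicitForm (hz : z ≠ 0) :
    Function.Injective (formDeriv (explicitForm α p z)) := by
  rw [injective_iff_map_eq_zero]
  intro d hd
  have hre : ∀ i, (explicitForm α p z i * d).re = 0 := fun i => by
    rw [← formDeriv_apply, hd]; rfl
  have hsum : (explicitForm α p z 0 * d) ^ 2 + (explicitForm α p z 1 * d) ^ 2 +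
      (explicitForm α p z 2 * d) ^ 2 = 0 := by
    linear_combination d ^ 2 * explicitForm_sum_sq (α := α) (p := p) hz
  have h2 := congrArg Complex.re hsum
  simp only [sq, add_re, mul_re (_ * _), hre, zero_re] at h2
  have him0 : (explicitForm α p z 0 * d).im = 0 := by nlinarith
  have him1 : (explicitForm α p z 1 * d).im = 0 := by nlinarith
  have e0 : explicitForm α p z 0 * d = 0 := Complex.ext (hre 0) him0
  have e1 : explicitForm α p z 1 * d = 0 := Complex.ext (hre 1) him1
  have hd0 : 1 / z * d = 0 := by
    have : explicitForm α p z 0 - I * explicitForm α p z 1 = 1 / z := by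
      simp only [explicitForm, Matrix.cons_val]
      linear_combination (-1 / 2 * (1 / z + z * heightCoeff α p z ^ 2)) * I_sq
    rw [← this]
    linear_combination e0 - I * e1
  exact (mul_eq_zero.1 hd0).resolve_left (one_div_ne_zero hz)

theorem IsBranch.partialDeriv_eq (h : IsBalancedConfig α p) {U : Set ℂ} {Y : ℂ → E3}
    (hY : IsBranch (weierstrassMap α p z₀) U Y) (hU : U ⊆ puncturedPlane p) (hz : z ∈ U) (d : ℂ) :
    partialDeriv Y d z = formDeriv (explicitForm α p z) d := by
  rw [partialDeriv, (hY.hasFDerivAt h hU hz).fderiv]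

/-- The forms are holomorphic, so second derivatives depend only on the product of the directions.
In particular `Y_vv = -Y_uu`, which together with conformality makes the mean curvature vanish. -/
theorem IsBranch.partialDeriv_partialDeriv_eq (h : IsBalancedConfig α p) {U : Set ℂ} {Y : ℂ → E3}
    (hY : IsBranch (weierstrassMap α p z₀) U Y) (hU : U ⊆ puncturedPlane p) (hz : z ∈ U)
    (d e : ℂ) :
    partialDeriv (partialDeriv Y d) e z =
      formDeriv (fun i => deriv (fun w => explicitForm α p w i) z) (d * e) := by
  have hev : partialDeriv Y d =ᶠ[𝓝 z] fun w => formDeriv (explicitForm α p w) d := by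
    filter_upwards [hY.1.mem_nhds hz] with w hw using hY.partialDeriv_eq h hU hw d
  have hder : HasFDerivAt (fun w => formDeriv (explicitForm α p w) d)
      (formDeriv (fun i => deriv (fun w => explicitForm α p w i) z * d)) z :=
    hasFDerivAt_formDeriv fun i =>
      ((differentiableAt_explicitForm (hU hz) i).hasDerivAt.mul_const d).hasFDerivAt_re
  rw [partialDeriv, hev.fderiv_eq, hder.fderiv]
  ext i
  simp only [formDeriv_apply, mul_assoc]

theorem IsBranch.meanCurvature_eq_zero (h : IsBalancedConfig α p) {U : Set ℂ} {Y : ℂ → E3}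
    (hY : IsBranch (weierstrassMap α p z₀) U Y) (hU : U ⊆ puncturedPlane p) (hz : z ∈ U) :
    meanCurvature Y z = 0 := by
  obtain ⟨hc1, hc2⟩ := explicitForm_conformal (α := α) (p := p) (hU hz).1
  have hE : inner ℝ (partialDeriv Y 1 z) (partialDeriv Y 1 z) =
      inner ℝ (partialDeriv Y I z) (partialDeriv Y I z) := by
    rw [hY.partialDeriv_eq h hU hz, hY.partialDeriv_eq h hU hz]
    simpa only [PiLp.inner_apply, formDeriv_apply, mul_one, mul_I_re, RCLike.inner_apply, conj_trivial,
      ← sq, neg_sq] using hc1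
  have hF : inner ℝ (partialDeriv Y 1 z) (partialDeriv Y I z) = 0 := by
    rw [hY.partialDeriv_eq h hU hz, hY.partialDeriv_eq h hU hz]
    simpa [PiLp.inner_apply, mul_comm] using hc2
  have hlap : partialDeriv (partialDeriv Y I) I z = -partialDeriv (partialDeriv Y 1) 1 z := by
    rw [hY.partialDeriv_partialDeriv_eq h hU hz, hY.partialDeriv_partialDeriv_eq h hU hz, I_mul_I,
      one_mul, map_neg]
  simp only [meanCurvature, hF, hlap, ← hE, inner_neg_left]
  ring_nf

theorem isMinimalImmersion_weierstrassMap (h : IsBalancedConfig α p) :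
    IsMinimalImmersion (puncturedPlane p) (weierstrassMap α p z₀) := by
  intro z hz
  let U := puncturedPlane p ∩ {w : ℂ | w / z ∈ slitPlane}
  have hUo : IsOpen U := (isOpen_puncturedPlane p).inter (isOpen_div_mem_slitPlane z)
  have hsub : U ⊆ puncturedPlane p := inter_subset_left
  have hsmooth : ContDiffOn ℝ ∞ (localBranch α p z₀ z) U := fun w hw =>
    (contDiffAt_localBranch hw.1 hw.2).contDiffWithinAt
  have hbr : IsBranch (weierstrassMap α p z₀) U (localBranch α p z₀ z) :=
    ⟨hUo, hsmooth.continuousOn, fun w hw => toQuot_localBranch hz.1 hw.1.1⟩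
  refine ⟨U, localBranch α p z₀ z, ⟨hz, div_self_mem_slitPlane hz.1⟩, hbr, hsmooth,
    fun w hw => ⟨?_, hbr.meanCurvature_eq_zero h hsub hw⟩⟩
  rw [(hbr.hasFDerivAt h hsub hw).fderiv]
  exact injective_formDeriv_explicitForm hw.1.1

/-- Inverse stereographic projection from the north pole. -/
def inverseStereographic (w : ℂ) : E3 :=
  (1 + normSq w)⁻¹ • !₂[2 * w.re, 2 * w.im, normSq w - 1]

theorem norm_inverseStereographic (w : ℂ) : ‖inverseStereographic w‖ = 1 := by
  have hpos : 0 < 1 + normSq w := by linarith [normSq_nonneg w]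
  have h1 : ‖(!₂[2 * w.re, 2 * w.im, normSq w - 1] : E3)‖ = 1 + normSq w := by
    rw [EuclideanSpace.norm_eq, Real.sqrt_eq_iff_mul_self_eq (by positivity) hpos.le]
    simp [Fin.sum_univ_three, normSq_apply]
    ring
  rw [inverseStereographic, norm_smul, h1, norm_inv, Real.norm_of_nonneg hpos.le,
    inv_mul_cancel₀ hpos.ne']

/-- The cross product of the partial derivatives is the unit vector with stereographic coordinate
`G`, times the positive factor `(1 + |G|²)² / (4 |z|²)`. -/
theorem IsBranch.unitNormal_eq (h : IsBalancedConfig α p) {U : Set ℂ} {Y : ℂ → E3}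
    (hY : IsBranch (weierstrassMap α p z₀) U Y) (hU : U ⊆ puncturedPlane p) (hz : z ∈ U) :
    unitNormal Y z = inverseStereographic (gaussFunction α p z) := by
  have hz0 := (hU hz).1
  have hform : explicitForm α p z = ![1 / 2 * z⁻¹ * (1 - gaussFunction α p z ^ 2),
      I / 2 * z⁻¹ * (1 + gaussFunction α p z ^ 2), z⁻¹ * gaussFunction α p z] := by
    simp only [explicitForm, gaussFunction]
    congr 1
    · field_simp
    congr 1
    · field_simp
    congr 1
    field_simp
  have hpos : 0 < (1 + normSq (gaussFunction α p z)) ^ 2 / 4 * normSq z⁻¹ := by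
    have := normSq_nonneg (gaussFunction α p z)
    have := normSq_pos.2 (inv_ne_zero hz0)
    positivity
  have hcross : (WithLp.toLp 2 (crossProduct (partialDeriv Y 1 z).ofLp
      (partialDeriv Y I z).ofLp) : E3) = ((1 + normSq (gaussFunction α p z)) ^ 2 / 4 *
        normSq z⁻¹) • inverseStereographic (gaussFunction α p z) := by
    rw [hY.partialDeriv_eq h hU hz, hY.partialDeriv_eq h hU hz, hform, inverseStereographic,
      smul_smul]
    have hne : 1 + normSq (gaussFunction α p z) ≠ 0 := by
      linarith [normSq_nonneg (gaussFunction α p z)]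
    have hs : (1 + normSq (gaussFunction α p z)) ^ 2 / 4 * normSq z⁻¹ *
        (1 + normSq (gaussFunction α p z))⁻¹ =
          (1 + normSq (gaussFunction α p z)) / 4 * normSq z⁻¹ := by
      field_simp
    rw [hs]
    generalize z⁻¹ = a
    generalize gaussFunction α p z = g
    ext i
    fin_cases i <;>
    · simp [crossProduct, normSq_apply, sq]
      ring
  rw [unitNormal]
  simp only [hcross]
  rw [norm_smul, norm_inverseStereographic, mul_one, Real.norm_of_nonneg hpos.le, smul_smul,
    inv_mul_cancel₀ hpos.ne', one_smul]

theorem isUnitNormalField_weierstrassMap (h : IsBalancedConfig α p) :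
    IsUnitNormalField (puncturedPlane p) (weierstrassMap α p z₀)
      fun z => inverseStereographic (gaussFunction α p z) :=
  fun _ _ hU hY _ hz => (hY.unitNormal_eq h hU hz).symm

end Branches

/-! ### Behaviour at the punctures and completeness -/

section Completeness

open Set Complex Filter

variable {m : ℕ} {α : Fin m → ℝ} {p : Fin m → ℂ} {z z₀ c : ℂ}

/-- The terms of `polarPrimitive` that are regular at `p k`. -/
def polarRest (α : Fin m → ℝ) (p : Fin m → ℂ) (k : Fin m) (z : ℂ) : ℂ :=
  -∑ j ∈ Finset.univ.erase k, (α j : ℂ) ^ 2 * p j / (z - p j)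

/-- The terms of `heightPotential` that are regular at `p k`. -/
def heightRest (α : Fin m → ℝ) (p : Fin m → ℂ) (k : Fin m) (z : ℂ) : ℝ :=
  ∑ j ∈ Finset.univ.erase k, α j * Real.log ‖z - p j‖

theorem polarPrimitive_eq_add_polarRest (k : Fin m) (z : ℂ) :
    polarPrimitive α p z = -((α k : ℂ) ^ 2 * p k / (z - p k)) + polarRest α p k z := by
  rw [polarPrimitive, polarRest, ← Finset.add_sum_erase _ _ (Finset.mem_univ k), neg_add]

theorem heightPotential_eq_add_heightRest (k : Fin m) (z : ℂ) :
    heightPotential α p z = α k * Real.log ‖z - p k‖ + heightRest α p k z := by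
  rw [heightPotential, heightRest,
    ← Finset.add_sum_erase _ (fun j => α j * Real.log ‖z - p j‖) (Finset.mem_univ k)]

theorem differentiableAt_heightRest (h : IsBalancedConfig α p) (k : Fin m) :
    DifferentiableAt ℝ (heightRest α p k) (p k) := by
  unfold heightRest
  refine DifferentiableAt.fun_sum fun j hj => ?_
  have hs : p k - p j ≠ 0 := sub_ne_zero.2 (h.inj.ne (Finset.mem_erase.1 hj).1.symm)
  exact (hasFDerivAt_log_norm_sub hs).differentiableAt.const_mul _

theorem contDiffAt_polarRest (h : IsBalancedConfig α p) (k : Fin m) :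
    ContDiffAt ℝ 1 (polarRest α p k) (p k) := by
  unfold polarRest
  refine (ContDiffAt.sum fun j hj => ?_).neg
  simp only [div_eq_mul_inv]
  exact contDiffAt_const.mul ((contDiffAt_id.sub contDiffAt_const).inv
    (sub_ne_zero.2 (h.inj.ne (Finset.mem_erase.1 hj).1.symm)))

theorem contDiffAt_polarPrimitive_zero (h : IsBalancedConfig α p) :
    ContDiffAt ℝ 1 (polarPrimitive α p) 0 := by
  unfold polarPrimitive
  refine (ContDiffAt.sum fun j _ => ?_).neg
  simp only [div_eq_mul_inv]
  exact contDiffAt_const.mul ((contDiffAt_id.sub contDiffAt_const).inv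
    (sub_ne_zero.2 (h.point_ne_zero j).symm))

theorem tendsto_log_norm_sub (q : ℂ) :
    Tendsto (fun z : ℂ => Real.log ‖z - q‖) (𝓝[≠] q) atBot := by
  refine Real.tendsto_log_nhdsGT_zero.comp ?_
  refine tendsto_nhdsWithin_iff.2 ⟨?_, ?_⟩
  · have : Tendsto (fun z : ℂ => ‖z - q‖) (𝓝 q) (𝓝 ‖q - q‖) := by
      apply Continuous.tendsto; fun_prop
    rw [sub_self, norm_zero] at this
    exact this.mono_left nhdsWithin_le_nhds
  · filter_upwards [self_mem_nhdsWithin] with z hz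
    exact norm_pos_iff.2 (sub_ne_zero.2 hz)

theorem tendsto_div_sub_cobounded (a q : ℂ) :
    Tendsto (fun z : ℂ => a / (z - q)) (Bornology.cobounded ℂ) (𝓝 0) := by
  have h1 : Tendsto (fun z : ℂ => z - q) (Bornology.cobounded ℂ) (Bornology.cobounded ℂ) := by
    simp only [← tendsto_norm_atTop_iff_cobounded]
    refine tendsto_atTop_mono (f := fun z : ℂ => ‖z‖ + -‖q‖) (fun z => ?_)
      (tendsto_atTop_add_const_right _ _ tendsto_norm_cobounded_atTop)
    linarith [norm_sub_norm_le z q]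
  simpa [div_eq_mul_inv] using ((tendsto_inv₀_cobounded.comp h1).const_mul a)

theorem tendsto_polarPrimitive_cobounded :
    Tendsto (polarPrimitive α p) (Bornology.cobounded ℂ) (𝓝 0) := by
  have := (tendsto_finsetSum (Finset.univ : Finset (Fin m))
    fun k _ => tendsto_div_sub_cobounded ((α k : ℂ) ^ 2 * p k) (p k)).neg
  rw [Finset.sum_const_zero, neg_zero] at this
  exact this

theorem weierstrassPrimitive_log_apply_zero (z : ℂ) :
    weierstrassPrimitive α p (log z) z 0 =
      1 / 2 * Real.log ‖z‖ - 1 / 2 * (polarPrimitive α p z).re := by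
  rw [← log_re]
  simp [weierstrassPrimitive]
  ring

theorem tendsto_first_coordinate_zero (h : IsBalancedConfig α p) :
    Tendsto (fun z => weierstrassPrimitive α p (log z) z 0) (𝓝[≠] 0) atBot := by
  simp only [weierstrassPrimitive_log_apply_zero, sub_eq_add_neg]
  have h1 := tendsto_log_norm_sub 0
  simp only [sub_zero] at h1
  have h2 : Tendsto (fun z => -(1 / 2 * (polarPrimitive α p z).re)) (𝓝[≠] 0)
      (𝓝 (-(1 / 2 * (polarPrimitive α p 0).re))) :=
    ((((continuous_re.tendsto _).comp (contDiffAt_polarPrimitive_zero h).continuousAt.tendsto).const_mul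
      (1 / 2 : ℝ)).neg).mono_left nhdsWithin_le_nhds
  exact (h1.const_mul_atBot (by norm_num : (0 : ℝ) < 1 / 2)).atBot_add h2

theorem tendsto_first_coordinate_cobounded :
    Tendsto (fun z => weierstrassPrimitive α p (log z) z 0) (Bornology.cobounded ℂ) atTop := by
  simp only [weierstrassPrimitive_log_apply_zero, sub_eq_add_neg]
  have h1 := Real.tendsto_log_atTop.comp (tendsto_norm_cobounded_atTop (E := ℂ))
  have h2 : Tendsto (fun z => -(1 / 2 * (polarPrimitive α p z).re)) (Bornology.cobounded ℂ)
      (𝓝 (-(1 / 2 * (0 : ℂ).re))) :=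
    (((continuous_re.tendsto _).comp tendsto_polarPrimitive_cobounded).const_mul (1 / 2 : ℝ)).neg
  exact (h1.const_mul_atTop (by norm_num : (0 : ℝ) < 1 / 2)).atTop_add h2

theorem tendsto_abs_heightPotential (h : IsBalancedConfig α p) (k : Fin m) :
    Tendsto (fun z => |heightPotential α p z|) (𝓝[≠] (p k)) atTop := by
  simp only [heightPotential_eq_add_heightRest k]
  have h1 := tendsto_log_norm_sub (p k)
  have h2 : Tendsto (heightRest α p k) (𝓝[≠] (p k)) (𝓝 (heightRest α p k (p k))) :=
    (differentiableAt_heightRest h k).continuousAt.tendsto.mono_left nhdsWithin_le_nhds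
  rcases lt_or_gt_of_ne (h.neck_ne_zero k) with hneg | hpos
  · exact tendsto_abs_atTop_atTop.comp ((h1.const_mul_atBot_of_neg hneg).atTop_add h2)
  · exact tendsto_abs_atBot_atTop.comp ((h1.const_mul_atBot hpos).atBot_add h2)

/-- The first and third coordinates are together a proper function on the punctured plane. -/
theorem exists_compact_coordinate_gt (h : IsBalancedConfig α p) (M : ℝ) :
    ∃ K : Set ℂ, IsCompact K ∧ K ⊆ puncturedPlane p ∧ ∀ z ∈ puncturedPlane p, z ∉ K →
      M < |weierstrassPrimitive α p (log z) z 0| ∨ M < |heightPotential α p z| := by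
  let P : ℂ → Prop := fun z =>
    M < |weierstrassPrimitive α p (log z) z 0| ∨ M < |heightPotential α p z|
  have e0 : ∀ᶠ z in 𝓝[≠] (0 : ℂ), P z :=
    ((tendsto_abs_atBot_atTop.comp (tendsto_first_coordinate_zero h)).eventually_gt_atTop M).mono
      fun z hz => Or.inl hz
  have einf : ∀ᶠ z in Bornology.cobounded ℂ, P z :=
    ((tendsto_abs_atTop_atTop.comp
      (tendsto_first_coordinate_cobounded (α := α) (p := p))).eventually_gt_atTop M).mono
      fun z hz => Or.inl hz
  have ek : ∀ k, ∀ᶠ z in 𝓝[≠] (p k), P z := fun k =>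
    ((tendsto_abs_heightPotential h k).eventually_gt_atTop M).mono fun z hz => Or.inr hz
  have hlocal : ∀ q : ℂ, (∀ᶠ z in 𝓝[≠] q, P z) →
      ∃ U : Set ℂ, IsOpen U ∧ q ∈ U ∧ ∀ z ∈ U, z ≠ q → P z := fun q hq => by
    obtain ⟨U, hU, hUo, hqU⟩ := eventually_nhds_iff.1 (eventually_nhdsWithin_iff.1 hq)
    exact ⟨U, hUo, hqU, hU⟩
  obtain ⟨U0, hU0o, hU0, hP0⟩ := hlocal 0 e0
  choose U hUo hU hPU using fun k => hlocal (p k) (ek k)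
  obtain ⟨r, hr⟩ := (Metric.hasBasis_cobounded_compl_closedBall (0 : ℂ)).eventually_iff.1 einf
  -- The compact set is a large disc with small neighbourhoods of all finite punctures removed.
  refine ⟨Metric.closedBall 0 r \ (U0 ∪ ⋃ k, U k), ?_, ?_, ?_⟩
  · exact (isCompact_closedBall 0 r).diff (hU0o.union (isOpen_iUnion hUo))
  · rintro z ⟨-, hz⟩
    refine ⟨?_, fun k => ?_⟩
    · rintro rfl; exact hz (Or.inl hU0)
    · rintro rfl; exact hz (Or.inr (mem_iUnion.2 ⟨k, hU k⟩))
  · intro z hz hzK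
    by_cases hzr : z ∈ Metric.closedBall 0 r
    · rcases not_not.1 fun hcon => hzK ⟨hzr, hcon⟩ with hzU | hzU
      · exact hP0 z hzU hz.1
      · obtain ⟨k, hk⟩ := mem_iUnion.1 hzU
        exact hPU k z hk (hz.2 k)
    · exact hr.2 hzr

/-- A coordinate unchanged by the period descends to a 1-Lipschitz function on the quotient. -/
theorem abs_apply_sub_le_dist_toQuot {i : Fin 3} (hi : periodVector i = 0) (x y : E3) :
    |x i - y i| ≤ dist (toQuot x) (toQuot y) := by
  have hxy : toQuot x - toQuot y = toQuot (x - y) := rfl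
  rw [dist_eq_norm, hxy, toQuot, QuotientAddGroup.le_norm_iff]
  intro v hv
  obtain ⟨k, hk⟩ := AddSubgroup.mem_zmultiples_iff.1 (toQuot_eq_iff.1 hv)
  have h1 : v i = x i - y i := by
    have := congrArg (fun w : E3 => w i) hk
    simp [hi] at this
    linarith
  rw [← h1]
  exact PiLp.norm_apply_le v i

/-- Finite length would bound the first and third coordinates along the path, which are jointly
proper. -/
theorem isCompleteSurface_weierstrassMap (h : IsBalancedConfig α p) :
    IsCompleteSurface (puncturedPlane p) (weierstrassMap α p z₀) := by
  intro γ _ hmaps hleave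
  by_contra hfin
  set V := eVariationOn (weierstrassMap α p z₀ ∘ γ) (Ico 0 1)
  have hdist : ∀ t ∈ Ico (0 : ℝ) 1,
      dist (weierstrassMap α p z₀ (γ t)) (weierstrassMap α p z₀ (γ 0)) ≤ V.toReal := fun t ht => by
    have := eVariationOn.edist_le (weierstrassMap α p z₀ ∘ γ) ht
      (⟨le_rfl, zero_lt_one⟩ : (0 : ℝ) ∈ Ico (0 : ℝ) 1)
    rw [dist_edist]
    exact ENNReal.toReal_mono hfin this
  have hcoord : ∀ i : Fin 3, periodVector i = 0 → ∀ t ∈ Ico (0 : ℝ) 1,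
      |weierstrassPrimitive α p (log (γ t)) (γ t) i -
        weierstrassPrimitive α p (log (γ 0)) (γ 0) i| ≤ V.toReal := fun i hi t ht => by
    have := (abs_apply_sub_le_dist_toQuot hi _ _).trans (hdist t ht)
    simpa using this
  let M := V.toReal + |weierstrassPrimitive α p (log (γ 0)) (γ 0) 0| +
    |weierstrassPrimitive α p (log (γ 0)) (γ 0) 2|
  obtain ⟨K, hK, hKS, hKM⟩ := exists_compact_coordinate_gt h M
  have hIco : ∀ᶠ t in 𝓝[<] (1 : ℝ), t ∈ Ico (0 : ℝ) 1 := Ico_mem_nhdsLT zero_lt_one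
  obtain ⟨t, ht, htK⟩ := (hIco.and (hleave K hK hKS)).exists
  have h0 := hcoord 0 (by simp [periodVector]) t ht
  have h2 := hcoord 2 (by simp [periodVector]) t ht
  have a0 := abs_nonneg (weierstrassPrimitive α p (log (γ 0)) (γ 0) 0)
  have a2 := abs_nonneg (weierstrassPrimitive α p (log (γ 0)) (γ 0) 2)
  have t0 := abs_sub_abs_le_abs_sub (weierstrassPrimitive α p (log (γ t)) (γ t) 0)
    (weierstrassPrimitive α p (log (γ 0)) (γ 0) 0)
  have t2 := abs_sub_abs_le_abs_sub (weierstrassPrimitive α p (log (γ t)) (γ t) 2)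
    (weierstrassPrimitive α p (log (γ 0)) (γ 0) 2)
  rcases hKM (γ t) (hmaps ht) htK with hlt | hlt
  · linarith
  · change M < |weierstrassPrimitive α p (log (γ t)) (γ t) 2| at hlt
    linarith

end Completeness

/-! ### The ends -/

section Ends

open Set Complex Filter

variable {m : ℕ} {α : Fin m → ℝ} {p : Fin m → ℂ} {z z₀ c : ℂ}

/-- A map `z ↦ (z - q) u(z)` with `u` continuously differentiable in the real sense and
`u(q) ≠ 0` restricts to a bijection from a punctured neighbourhood of `q` onto a punctured disc. -/
theorem exists_punctured_chart {u : ℂ → ℂ} {q : ℂ} (hu : ContDiffAt ℝ 1 u q) (hq : u q ≠ 0)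
    {W : Set ℂ} (hW : W ∈ 𝓝 q) :
    ∃ (V : Set ℂ) (δ C : ℝ), IsOpen V ∧ V ∈ 𝓝[≠] q ∧ V ⊆ W \ {q} ∧ 0 < δ ∧ 0 < C ∧
      BijOn (fun z => (z - q) * u z) V (Metric.ball 0 δ \ {0}) ∧
      (∀ z ∈ V, ‖z - q‖ ≤ C * ‖(z - q) * u z‖) ∧ ∀ z ∈ V, u z ≠ 0 := by
  set g : ℂ → ℂ := fun z => (z - q) * u z with hgdef
  -- At `q` the factor `z - q` kills the derivative of `u`, so the differential is multiplication by
  -- `u q`, and the inverse function theorem applies.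
  let E : ℂ ≃L[ℝ] ℂ :=
    (ContinuousLinearEquiv.unitsEquivAut ℂ (Units.mk0 (u q) hq)).restrictScalars ℝ
  have hstrict : HasStrictFDerivAt g (E : ℂ →L[ℝ] ℂ) q := by
    have h1 : HasStrictFDerivAt (fun z : ℂ => z - q) (ContinuousLinearMap.id ℝ ℂ) q :=
      (hasStrictFDerivAt_id q).sub_const q
    refine (h1.mul (hu.hasStrictFDerivAt one_ne_zero)).congr_fderiv ?_
    ext
    simp [E, mul_comm]
  let e := hstrict.toOpenPartialHomeomorph g
  have hqs : q ∈ e.source := hstrict.mem_toOpenPartialHomeomorph_source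
  have heg : ∀ z, e z = g z := fun z => rfl
  have hgq : g q = 0 := by simp [g]
  have hqt : (0 : ℂ) ∈ e.target := hgq ▸ hstrict.image_mem_toOpenPartialHomeomorph_target
  have hsymm0 : e.symm 0 = q := by rw [← hgq, ← heg, e.left_inv hqs]
  have hnear : ∀ᶠ z in 𝓝 q, ‖u q‖ / 2 < ‖u z‖ :=
    hu.continuousAt.norm.eventually_const_lt (by linarith [norm_pos_iff.2 hq])
  have hW' : W ∩ {z | ‖u q‖ / 2 < ‖u z‖} ∈ 𝓝 q := inter_mem hW hnear
  have hpre : e.symm ⁻¹' (W ∩ {z | ‖u q‖ / 2 < ‖u z‖}) ∈ 𝓝 (0 : ℂ) :=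
    (e.continuousAt_symm hqt).preimage_mem_nhds (hsymm0.symm ▸ hW')
  obtain ⟨δ, hδ, hball⟩ := Metric.mem_nhds_iff.1 (inter_mem hpre (e.open_target.mem_nhds hqt))
  have hopen : IsOpen (e.source ∩ e ⁻¹' Metric.ball 0 δ) := e.isOpen_inter_preimage Metric.isOpen_ball
  have hzero : ∀ z ∈ e.source, g z = 0 → z = q := fun z hz hgz =>
    e.injOn hz hqs (by rw [heg, heg, hgz, hgq])
  have hmem : ∀ z ∈ e.source, g z ∈ Metric.ball (0 : ℂ) δ →
      z ∈ W ∩ {z | ‖u q‖ / 2 < ‖u z‖} := fun z hz hgz => by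
    have := (hball hgz).1
    rwa [mem_preimage, ← heg, e.left_inv hz] at this
  refine ⟨(e.source ∩ e ⁻¹' Metric.ball 0 δ) \ {q}, δ, 2 / ‖u q‖,
    hopen.sdiff isClosed_singleton, ?_, ?_, hδ, by have := norm_pos_iff.2 hq; positivity, ?_, ?_, ?_⟩
  · refine sdiff_mem_nhdsWithin_compl (hopen.mem_nhds ⟨hqs, ?_⟩) _
    simp [heg, hgq, hδ]
  · rintro z ⟨⟨hz, hgz⟩, hzq⟩
    exact ⟨(hmem z hz hgz).1, hzq⟩
  · refine ⟨?_, ?_, ?_⟩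
    · rintro z ⟨⟨hz, hgz⟩, hzq⟩
      exact ⟨hgz, fun h0 => hzq (hzero z hz h0)⟩
    · rintro z ⟨⟨hz, -⟩, -⟩ w ⟨⟨hw, -⟩, -⟩ hzw
      exact e.injOn hz hw hzw
    · rintro w ⟨hw, hw0⟩
      have hwt := (hball hw).2
      have hgw : g (e.symm w) = w := by rw [← heg, e.right_inv hwt]
      refine ⟨e.symm w, ⟨⟨e.map_target hwt, ?_⟩, fun hcon => hw0 ?_⟩, hgw⟩
      · rw [mem_preimage, heg, hgw]; exact hw
      · rw [mem_singleton_iff] at hcon ⊢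
        rw [← hgw, hcon, hgq]
  · rintro z ⟨⟨hz, hgz⟩, -⟩
    have h1 : ‖u q‖ / 2 < ‖u z‖ := (hmem z hz hgz).2
    have h0 := norm_pos_iff.2 hq
    rw [norm_mul, div_mul_eq_mul_div, le_div_iff₀ h0]
    nlinarith [norm_nonneg (z - q)]
  · rintro z ⟨⟨hz, hgz⟩, -⟩ h0
    have h1 : ‖u q‖ / 2 < ‖u z‖ := (hmem z hz hgz).2
    rw [h0, norm_zero] at h1
    linarith [norm_nonneg (u q)]

/-- The horizontal projection to the complex plane. -/
def horizontalProj (x : E3) : ℂ := ⟨x 0, x 1⟩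

theorem horizontalNorm_eq (x : E3) : horizontalNorm x = ‖horizontalProj x‖ := by
  rw [horizontalNorm, Complex.norm_eq_sqrt_sq_add_sq, horizontalProj]

/-- In the complex coordinate `x₁ + i x₂` the logarithm enters conjugated and `B` does not. The
charts at the ends are therefore only real-differentiable. -/
theorem horizontalProj_weierstrassPrimitive (l z : ℂ) :
    horizontalProj (weierstrassPrimitive α p l z) =
      1 / 2 * (starRingEnd ℂ l - polarPrimitive α p z) := by
  apply Complex.ext
  · simp [horizontalProj, weierstrassPrimitive]
  · simp [horizontalProj, weierstrassPrimitive]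
    ring

theorem horizontalProj_sub (x y : E3) :
    horizontalProj (x - y) = horizontalProj x - horizontalProj y := rfl

theorem e3_ext {x y : E3} (h : horizontalProj x = horizontalProj y) (h2 : x 2 = y 2) : x = y := by
  ext i
  fin_cases i
  · exact congrArg Complex.re h
  · exact congrArg Complex.im h
  · exact h2

/-- A surface whose horizontal projection is the inverse of a bijection onto a punctured disc is
a graph over the exterior of a disc. -/
theorem bijOn_graph_of_bijOn_inv {g : ℂ → ℂ} {V : Set ℂ} {δ : ℝ} (hδ : 0 < δ) {Y : ℂ → E3}
    (hg : BijOn g V (Metric.ball 0 δ \ {0})) (hY : ∀ z ∈ V, horizontalProj (Y z) = (g z)⁻¹) :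
    BijOn Y V {x : E3 | δ⁻¹ < horizontalNorm x ∧
      x 2 = Y (Function.invFunOn g V (⟨x 0, x 1⟩ : ℂ)⁻¹) 2} := by
  refine ⟨fun z hz => ?_, fun z hz w hw hzw => ?_, fun x hx => ?_⟩
  · have hgz := hg.mapsTo hz
    have hg0 : 0 < ‖g z‖ := norm_pos_iff.2 hgz.2
    refine ⟨?_, ?_⟩
    · rw [horizontalNorm_eq, hY z hz, norm_inv, inv_lt_inv₀ hδ hg0]
      simpa using hgz.1
    · change Y z 2 = Y (Function.invFunOn g V (horizontalProj (Y z))⁻¹) 2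
      rw [hY z hz, inv_inv, hg.injOn.leftInvOn_invFunOn hz]
  · apply hg.injOn hz hw
    rw [← inv_inj, ← hY z hz, ← hY w hw, hzw]
  · obtain ⟨hR, hx2⟩ := hx
    rw [horizontalNorm_eq] at hR
    have hpos : 0 < ‖horizontalProj x‖ := (inv_pos.2 hδ).trans hR
    have hmem : (horizontalProj x)⁻¹ ∈ Metric.ball (0 : ℂ) δ \ {0} := by
      refine ⟨?_, inv_ne_zero (norm_pos_iff.1 hpos)⟩
      rw [mem_ball_zero_iff, norm_inv]
      exact inv_lt_of_inv_lt₀ hδ hR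
    have himg : (horizontalProj x)⁻¹ ∈ g '' V := hg.surjOn hmem
    refine ⟨Function.invFunOn g V (horizontalProj x)⁻¹, Function.invFunOn_mem himg, e3_ext ?_ ?_⟩
    · rw [hY _ (Function.invFunOn_mem himg), Function.invFunOn_eq himg, inv_inv]
    · exact hx2.symm

theorem isBranch_localBranch (h : IsBalancedConfig α p) {V : Set ℂ} (hV : IsOpen V)
    (hVS : V ⊆ puncturedPlane p) (hc : c ≠ 0) (hVc : ∀ z ∈ V, z / c ∈ slitPlane) :
    IsBranch (weierstrassMap α p z₀) V (localBranch α p z₀ c) :=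
  ⟨hV, fun _ hz => (hasFDerivAt_localBranch h (hVS hz) (hVc _ hz)).continuousAt.continuousWithinAt,
    fun _ hz => toQuot_localBranch hc (hVS hz).1⟩

theorem contDiffAt_conj_localLog (hc : c ≠ 0) :
    ContDiffAt ℝ 1 (fun z => starRingEnd ℂ (localLog c z)) c := by
  have hL : ContDiffAt ℝ 1 (localLog c) c :=
    (contDiffAt_localLog (div_self_mem_slitPlane hc)).of_le (by exact_mod_cast le_top)
  exact conjCLE.contDiff.contDiffAt.comp c hL

/-- The projection is `A/(z - q) + s(z)` with `s` smooth, so its inverse `(z - q) v(z)` is a chart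
of modulus `1/r`. The height is `α_k log |(z - q) v| + ρ(z)`, and differentiability of `ρ` at `q`
gives the error `O(|z - q|) = O(1/r)`. -/
theorem isCatenoidalEnd_weierstrassMap (h : IsBalancedConfig α p) (z₀ : ℂ) (k : Fin m) :
    IsCatenoidalEnd (puncturedPlane p) (weierstrassMap α p z₀) (p k) (-α k) := by
  set q := p k with hqdef
  have hq0 : q ≠ 0 := h.point_ne_zero k
  set c₀ := weierstrassPrimitive α p (log z₀) z₀ with hc₀
  -- The residue of `-½ B` at `q`.
  set A : ℂ := (α k : ℂ) ^ 2 * q / 2 with hA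
  have hA0 : A ≠ 0 := by
    have := h.neck_ne_zero k
    simp [A, hq0, this]
  let s : ℂ → ℂ := fun z =>
    1 / 2 * (starRingEnd ℂ (localLog q z) - polarRest α p k z) - horizontalProj c₀
  have hs : ContDiffAt ℝ 1 s q :=
    (contDiffAt_const.mul ((contDiffAt_conj_localLog hq0).sub (contDiffAt_polarRest h k))).sub
      contDiffAt_const
  let v : ℂ → ℂ := fun z => (A + (z - q) * s z)⁻¹
  have hv : ContDiffAt ℝ 1 v q := by
    refine ContDiffAt.inv (contDiffAt_const.add ((contDiffAt_id.sub contDiffAt_const).mul hs)) ?_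
    simpa using hA0
  have hvq : v q ≠ 0 := by simp [v, hA0]
  -- The term `-α_k log |v|` pays for replacing `|z - q|` by `|(z - q) v|` in the logarithm.
  let ρ : ℂ → ℝ := fun z => -(α k * Real.log ‖v z‖) + heightRest α p k z - c₀ 2
  have hρ : DifferentiableAt ℝ ρ q := by
    have h1 : DifferentiableAt ℝ (fun z => Real.log ‖v z‖) q :=
      ((hv.differentiableAt one_ne_zero).norm ℝ hvq).log (norm_ne_zero_iff.2 hvq)
    exact (((h1.const_mul (α k)).neg).add (differentiableAt_heightRest h k)).sub_const _
  obtain ⟨K, hK⟩ := hρ.isBigO_sub.bound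
  have hW : {z | (z ≠ 0 ∧ ∀ j, j ≠ k → z ≠ p j) ∧ z / q ∈ slitPlane ∧
      ‖ρ z - ρ q‖ ≤ K * ‖z - q‖} ∈ 𝓝 q := by
    refine inter_mem (inter_mem (isOpen_ne.mem_nhds hq0) ?_) (inter_mem
      ((isOpen_div_mem_slitPlane q).mem_nhds (div_self_mem_slitPlane hq0)) hK)
    refine eventually_all.2 fun j => ?_
    by_cases hjk : j = k
    · exact Eventually.of_forall fun z hz => absurd hjk hz
    · filter_upwards [isOpen_ne.mem_nhds (h.inj.ne (Ne.symm hjk))] with z hz _ using hz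
  obtain ⟨V, δ, C, hVo, hVn, hVW, hδ, hC, hbij, hle, hvV⟩ := exists_punctured_chart hv hvq hW
  have hVS : V ⊆ puncturedPlane p := fun z hz => by
    obtain ⟨⟨⟨h0, hj⟩, -⟩, hzq⟩ := hVW hz
    refine ⟨h0, fun j => ?_⟩
    by_cases hjk : j = k
    · rw [hjk]; exact hzq
    · exact hj j hjk
  set Y := localBranch α p z₀ q with hY
  have hYbr : IsBranch (weierstrassMap α p z₀) V Y :=
    isBranch_localBranch h hVo hVS hq0 fun z hz => (hVW hz).1.2.1
  have hproj : ∀ z ∈ V, horizontalProj (Y z) = ((z - q) * v z)⁻¹ := fun z hz => by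
    have hzq : z - q ≠ 0 := sub_ne_zero.2 (hVW hz).2
    have hden : A + (z - q) * s z ≠ 0 := fun h0 => hvV z hz (by simp [v, h0])
    rw [hY, localBranch, horizontalProj_sub, horizontalProj_weierstrassPrimitive,
      polarPrimitive_eq_add_polarRest k, ← hqdef]
    simp only [v]
    rw [mul_inv, inv_inv]
    simp only [s, A]
    field_simp
    ring
  have hheight : ∀ z ∈ V, Y z 2 = α k * Real.log ‖(z - q) * v z‖ + ρ z := fun z hz => by
    have hzq : ‖z - q‖ ≠ 0 := norm_ne_zero_iff.2 (sub_ne_zero.2 (hVW hz).2)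
    rw [norm_mul, Real.log_mul hzq (norm_ne_zero_iff.2 (hvV z hz))]
    change heightPotential α p z - c₀ 2 = _
    rw [heightPotential_eq_add_heightRest k]
    simp only [ρ]
    ring
  refine ⟨neg_ne_zero.2 (h.neck_ne_zero k), V, Y, fun a b =>
    Y (Function.invFunOn (fun z => (z - q) * v z) V (⟨a, b⟩ : ℂ)⁻¹) 2, δ⁻¹, ρ q, |K| * C,
    hVn, hVS, hYbr, inv_pos.2 hδ, bijOn_graph_of_bijOn_inv hδ hbij hproj, ?_, ?_⟩
  · intro x hx
    rw [horizontalNorm_eq] at hx ⊢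
    have hpos : 0 < ‖horizontalProj x‖ := (inv_pos.2 hδ).trans hx
    have himg : (horizontalProj x)⁻¹ ∈ (fun z => (z - q) * v z) '' V := by
      refine hbij.surjOn ⟨?_, inv_ne_zero (norm_pos_iff.1 hpos)⟩
      rw [mem_ball_zero_iff, norm_inv]
      exact inv_lt_of_inv_lt₀ hδ hx
    obtain ⟨hzV, hgz⟩ := Function.invFunOn_pos himg
    change |Y (Function.invFunOn (fun z => (z - q) * v z) V (horizontalProj x)⁻¹) 2 - _| ≤ _
    set z := Function.invFunOn (fun z => (z - q) * v z) V (horizontalProj x)⁻¹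
    rw [hheight z hzV, hgz, norm_inv, Real.log_inv]
    have e1 : α k * -Real.log ‖horizontalProj x‖ + ρ z -
        (-α k * Real.log ‖horizontalProj x‖ + ρ q) = ρ z - ρ q := by ring
    rw [e1]
    have b1 : |ρ z - ρ q| ≤ K * ‖z - q‖ := (hVW hzV).1.2.2
    have b2 := hle z hzV
    have b3 : ‖(z - q) * v z‖ = ‖horizontalProj x‖⁻¹ := by
      rw [← norm_inv]; exact congrArg norm hgz
    rw [b3] at b2
    calc |ρ z - ρ q| ≤ K * ‖z - q‖ := b1
      _ ≤ |K| * ‖z - q‖ := mul_le_mul_of_nonneg_right (le_abs_self K) (norm_nonneg _)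
      _ ≤ |K| * (C * ‖horizontalProj x‖⁻¹) := mul_le_mul_of_nonneg_left b2 (abs_nonneg K)
      _ = _ := by rw [div_eq_mul_inv, mul_assoc]
  · have hlim : Tendsto (fun z => ‖(z - q) * v z‖) (𝓝[≠] q) (𝓝[>] 0) := by
      refine tendsto_nhdsWithin_iff.2 ⟨?_, ?_⟩
      · have : ContinuousAt (fun z => ‖(z - q) * v z‖) q :=
          ((continuousAt_id.sub continuousAt_const).mul hv.continuousAt).norm
        have h2 := this.tendsto
        simp only [sub_self, zero_mul, norm_zero] at h2
        exact h2.mono_left nhdsWithin_le_nhds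
      · filter_upwards [hVn] with z hz
        exact norm_pos_iff.2 (hbij.mapsTo hz).2
    refine (tendsto_inv_nhdsGT_zero.comp hlim).congr' ?_
    filter_upwards [hVn] with z hz
    rw [horizontalNorm_eq, hproj z hz, norm_inv]
    rfl

end Ends

/-! ### Horizontal annular ends at `0` and `∞` -/

section AnnularEnds

open Set Complex Filter

variable {m : ℕ} {α : Fin m → ℝ} {p : Fin m → ℂ} {z z₀ c : ℂ}

/-- For `σ = ±1`, a coordinate on the quotient of the horizontal plane by `(0, π)` that tends to
zero as `σ x₁ → ∞`. -/
def annularCoord (σ a b : ℝ) : ℂ := exp (-2 * σ * (a - b * I))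

theorem norm_annularCoord (σ a b : ℝ) : ‖annularCoord σ a b‖ = Real.exp (-2 * (σ * a)) := by
  rw [annularCoord, norm_exp]
  congr 1
  simp
  ring

theorem annularCoord_add_pi {σ : ℝ} (hσ : σ = 1 ∨ σ = -1) (a b : ℝ) :
    annularCoord σ a (b + π) = annularCoord σ a b := by
  rw [annularCoord, annularCoord, exp_eq_exp_iff_exists_int]
  rcases hσ with rfl | rfl
  · refine ⟨1, ?_⟩
    push_cast
    ring
  · refine ⟨-1, ?_⟩
    push_cast
    ring

theorem toQuot_eq_of_annularCoord_eq {σ : ℝ} (hσ : σ = 1 ∨ σ = -1) {x y : E3}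
    (h : annularCoord σ (x 0) (x 1) = annularCoord σ (y 0) (y 1)) (h2 : x 2 = y 2) :
    toQuot x = toQuot y := by
  rw [annularCoord, annularCoord, exp_eq_exp_iff_exists_int] at h
  obtain ⟨N, hN⟩ := h
  have hre := congrArg Complex.re hN
  have him := congrArg Complex.im hN
  simp at hre him
  rw [toQuot_eq_iff, AddSubgroup.mem_zmultiples_iff]
  rcases hσ with rfl | rfl
  · refine ⟨N, ?_⟩
    have hre' : x 0 = y 0 := by simpa using hre
    ext i
    fin_cases i
    · simp [periodVector, hre']
    · simp [periodVector]; linarith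
    · simp [periodVector, h2]
  · refine ⟨-N, ?_⟩
    have hre' : x 0 = y 0 := by simpa using hre
    ext i
    fin_cases i
    · simp [periodVector, hre']
    · simp [periodVector]; linarith
    · simp [periodVector, h2]

theorem annularCoord_eq_of_toQuot_eq {σ : ℝ} (hσ : σ = 1 ∨ σ = -1) {x y : E3}
    (h : toQuot x = toQuot y) : annularCoord σ (x 0) (x 1) = annularCoord σ (y 0) (y 1) := by
  obtain ⟨k, hk⟩ := AddSubgroup.mem_zmultiples_iff.1 (toQuot_eq_iff.1 h)
  have h0 := congrArg (fun w : E3 => w 0) hk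
  have h1 := congrArg (fun w : E3 => w 1) hk
  simp [periodVector] at h0 h1
  have e0 : x 0 = y 0 := by linarith
  have e1 : x 1 = y 1 + k * π := by linarith
  rw [annularCoord, annularCoord, e0, e1, exp_eq_exp_iff_exists_int]
  rcases hσ with rfl | rfl
  · refine ⟨k, ?_⟩
    push_cast
    ring
  · refine ⟨-k, ?_⟩
    push_cast
    ring

theorem continuousAt_weierstrassMap (h : IsBalancedConfig α p) (hz : z ∈ puncturedPlane p) :
    ContinuousAt (weierstrassMap α p z₀) z := by
  have h1 : ContinuousAt (localBranch α p z₀ z) z :=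
    (hasFDerivAt_localBranch h hz (div_self_mem_slitPlane hz.1)).continuousAt
  have h2 : ContinuousAt (fun w => toQuot (localBranch α p z₀ z w)) z :=
    (continuous_quotient_mk'.tendsto _).comp h1
  refine h2.congr ?_
  filter_upwards [isOpen_ne.mem_nhds hz.1] with w hw using toQuot_localBranch hz.1 hw

/-- The lift of the Weierstrass map through the principal branch of the logarithm. -/
def principalLift (α : Fin m → ℝ) (p : Fin m → ℂ) (z₀ z : ℂ) : E3 :=
  weierstrassPrimitive α p (log z) z - weierstrassPrimitive α p (log z₀) z₀

theorem toQuot_principalLift (z₀ z : ℂ) :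
    toQuot (principalLift α p z₀ z) = weierstrassMap α p z₀ z := rfl

theorem annularCoord_eq_exp_conj (σ : ℝ) (x : E3) :
    annularCoord σ (x 0) (x 1) = exp (-2 * σ * starRingEnd ℂ (horizontalProj x)) := by
  rw [annularCoord]
  congr 2
  apply Complex.ext <;> simp [horizontalProj]

/-- After conjugation `½ log z` appears unconjugated, so `annularCoord` is `z` (for `σ = -1`) or
`1/z` (for `σ = 1`) times an exponential that is smooth at the end. -/
theorem conj_horizontalProj_principalLift (z₀ z : ℂ) :
    starRingEnd ℂ (horizontalProj (principalLift α p z₀ z)) =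
      1 / 2 * (log z - starRingEnd ℂ (polarPrimitive α p z)) -
        starRingEnd ℂ (horizontalProj (weierstrassPrimitive α p (log z₀) z₀)) := by
  rw [principalLift, horizontalProj_sub, horizontalProj_weierstrassPrimitive, map_sub, map_mul,
    map_sub, conj_conj]
  have h2 : starRingEnd ℂ (1 / 2) = 1 / 2 := by simp [conj_ofNat]
  rw [h2]

/-- A criterion for horizontal annular ends: in a coordinate `w = τ(z)` that vanishes at the end,
the annular coordinate of the surface is `w u(w)` with `u(0) ≠ 0`, and the height extends
continuously to `w = 0`. -/
theorem isHorizontalAnnularEnd_of_chart (h : IsBalancedConfig α p) {σ : ℝ} (hσ : σ = 1 ∨ σ = -1)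
    {e : Filter ℂ} {τ : ℂ → ℂ} (hτ : ∀ z, τ (τ z) = z) (hτc : ContinuousOn τ {0}ᶜ) (hτ0 : τ 0 = 0)
    (hτe : Tendsto τ e (𝓝[≠] 0)) {u : ℂ → ℂ} (hu : ContDiffAt ℝ 1 u 0) (hu0 : u 0 ≠ 0)
    {W : Set ℂ} (hW : W ∈ 𝓝 0) (hWS : ∀ w ∈ W, w ≠ 0 → τ w ∈ puncturedPlane p)
    (hWu : ∀ w ∈ W, w ≠ 0 → annularCoord σ (principalLift α p z₀ (τ w) 0)
      (principalLift α p z₀ (τ w) 1) = w * u w)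
    {H : ℂ → ℝ} (hH : ContinuousAt H 0)
    (hWH : ∀ w ∈ W, w ≠ 0 → principalLift α p z₀ (τ w) 2 = H w)
    (hlim : Tendsto (fun z => σ * principalLift α p z₀ z 0) e atTop) :
    IsHorizontalAnnularEnd (puncturedPlane p) (weierstrassMap α p z₀) e := by
  obtain ⟨V', δ, C, hVo, hVn, hVW, hδ, hC, hbij, hle, -⟩ := exists_punctured_chart hu hu0 hW
  simp only [sub_zero] at hbij hle
  set g : ℂ → ℂ := fun w => w * u w with hg
  set x : ℂ → E3 := principalLift α p z₀ with hx
  have hV'0 : ∀ w ∈ V', w ≠ 0 := fun w hw => (hVW hw).2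
  have hcoord : ∀ w ∈ V', annularCoord σ (x (τ w) 0) (x (τ w) 1) = g w := fun w hw =>
    hWu w (hVW hw).1 (hV'0 w hw)
  -- Inversion is continuous only off `0`, where Lean assigns it the value `0`.
  let V : Set ℂ := {0}ᶜ ∩ τ ⁻¹' V'
  have hVτ : ∀ w ∈ V', τ w ∈ V := fun w hw =>
    ⟨fun h0 => hV'0 w hw (by rw [← hτ w, mem_singleton_iff.1 h0, hτ0]),
      by rw [mem_preimage, hτ]; exact hw⟩
  have hVS : V ⊆ puncturedPlane p := fun z hz => by
    have := hWS (τ z) (hVW hz.2).1 (hV'0 _ hz.2)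
    rwa [hτ] at this
  let G : ℂ → ℂ := Function.invFunOn g V'
  let U : ℝ → ℝ → ℝ := fun s t => x (τ (G (annularCoord σ s t))) 2
  -- Since `|annularCoord σ s t| = exp (-2σs)`, the disc of radius `δ` corresponds to `σs > -(log
  -- δ)/2`.
  have hmem : ∀ s t : ℝ, -Real.log δ / 2 < σ * s → annularCoord σ s t ∈ g '' V' :=
    fun s t hst => by
      refine hbij.surjOn ⟨?_, exp_ne_zero _⟩
      rw [mem_ball_zero_iff, norm_annularCoord, ← Real.lt_log_iff_exp_lt hδ]
      linarith
  refine ⟨V, U, σ, -Real.log δ / 2, H 0, hτc.isOpen_inter_preimage isOpen_compl_singleton hVo, ?_,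
    hVS, fun z hz => (continuousAt_weierstrassMap h (hVS hz)).continuousWithinAt, hσ, fun s t => ?_,
    ⟨fun z hz => ?_, fun z hz w hw hzw => ?_, ?_⟩, fun η hη => ?_, fun M => ?_⟩
  · filter_upwards [hτe hVn, hτe self_mem_nhdsWithin] with z hz hz0
    refine ⟨fun h0 => hz0 ?_, hz⟩
    rw [mem_singleton_iff.1 h0, hτ0]; rfl
  · simp only [U, annularCoord_add_pi hσ]
  · have hc := hcoord _ hz.2
    rw [hτ] at hc
    have hgz := (hbij.mapsTo hz.2).1
    rw [← hc, mem_ball_zero_iff, norm_annularCoord, ← Real.lt_log_iff_exp_lt hδ] at hgz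
    refine ⟨x z, ⟨by linarith, ?_⟩, toQuot_principalLift z₀ z⟩
    simp only [U, G]
    rw [hc, hbij.injOn.leftInvOn_invFunOn hz.2, hτ]
  · have h1 := hcoord _ hz.2
    have h2 := hcoord _ hw.2
    rw [hτ] at h1 h2
    have h3 : g (τ z) = g (τ w) := by
      rw [← h1, ← h2]
      exact annularCoord_eq_of_toQuot_eq hσ hzw
    rw [← hτ z, hbij.injOn hz.2 hw.2 h3, hτ]
  · rintro _ ⟨y, ⟨hyR, hy2⟩, rfl⟩
    have himg := hmem (y 0) (y 1) hyR
    obtain ⟨hGV, hgG⟩ := Function.invFunOn_pos himg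
    refine ⟨τ (G (annularCoord σ (y 0) (y 1))), hVτ _ hGV, ?_⟩
    rw [← toQuot_principalLift]
    exact toQuot_eq_of_annularCoord_eq hσ ((hcoord _ hGV).trans hgG) hy2.symm
  · obtain ⟨r, hr, hrH⟩ := Metric.continuousAt_iff.1 hH η hη
    refine ⟨max (-Real.log δ / 2) (-Real.log (r / C) / 2), fun s t hst => ?_⟩
    obtain ⟨hst1, hst2⟩ := max_lt_iff.1 hst
    obtain ⟨hGV, hgG⟩ := Function.invFunOn_pos (hmem s t hst1)
    have hGle := hle _ hGV
    have hnorm : ‖annularCoord σ s t‖ < r / C := by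
      rw [norm_annularCoord, ← Real.lt_log_iff_exp_lt (div_pos hr hC)]
      linarith
    have hG : ‖G (annularCoord σ s t)‖ < r := by
      refine hGle.trans_lt ?_
      have : ‖g (Function.invFunOn g V' (annularCoord σ s t))‖ < r / C := by rw [hgG]; exact hnorm
      rw [lt_div_iff₀ hC] at this
      linarith
    have := hrH (x := G (annularCoord σ s t)) (by simpa using hG)
    rw [Real.dist_eq] at this
    simp only [U]
    rw [hx, hWH _ (hVW hGV).1 (hV'0 _ hGV)]
    exact this
  · filter_upwards [hlim.eventually_gt_atTop M] with z hz
    exact ⟨x z, hz, toQuot_principalLift z₀ z⟩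

theorem isHorizontalAnnularEnd_zero (h : IsBalancedConfig α p) (z₀ : ℂ) :
    IsHorizontalAnnularEnd (puncturedPlane p) (weierstrassMap α p z₀) (𝓝[≠] 0) := by
  set c₀ := weierstrassPrimitive α p (log z₀) z₀ with hc₀
  have hu : ContDiffAt ℝ 1 (fun w => exp (-starRingEnd ℂ (polarPrimitive α p w) -
      2 * starRingEnd ℂ (horizontalProj c₀))) 0 :=
    ((conjCLE.contDiff.contDiffAt.comp 0 (contDiffAt_polarPrimitive_zero h)).neg.sub
      contDiffAt_const).cexp
  have hW : {w : ℂ | ∀ j, w ≠ p j} ∈ 𝓝 (0 : ℂ) :=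
    eventually_all.2 fun j => isOpen_ne.mem_nhds (h.point_ne_zero j).symm
  have hH : ContinuousAt (fun w => heightPotential α p w - c₀ 2) 0 := by
    refine ContinuousAt.sub ?_ continuousAt_const
    unfold heightPotential
    refine tendsto_finsetSum _ fun j _ => ContinuousAt.mul continuousAt_const ?_
    have hj : (0 : ℂ) - p j ≠ 0 := sub_ne_zero.2 (h.point_ne_zero j).symm
    exact (hasFDerivAt_log_norm_sub hj).continuousAt
  refine isHorizontalAnnularEnd_of_chart (τ := id) h (Or.inr rfl) (fun _ => rfl) continuousOn_id rfl
    tendsto_id hu (exp_ne_zero _) hW (fun w hw hw0 => ⟨hw0, hw⟩) (fun w hw hw0 => ?_) hH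
    (fun w hw hw0 => rfl) ?_
  · rw [annularCoord_eq_exp_conj, id, conj_horizontalProj_principalLift]
    nth_rewrite 3 [← exp_log hw0]
    rw [← exp_add]
    congr 1
    push_cast
    ring
  · have h1 := (tendsto_first_coordinate_zero h).atBot_add
      (tendsto_const_nhds (x := -(c₀ 0)))
    refine (tendsto_neg_atBot_atTop.comp h1).congr fun z => ?_
    simp [principalLift, hc₀, sub_eq_add_neg]

/-- In `w = 1/z` the function `B` becomes smooth at `w = 0`, and the height is `∑ α_k log |1 - p_k
w|` up to a constant, because the common term `log |1/w|` has total weight `∑ α_k = 0`. -/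
theorem isHorizontalAnnularEnd_cobounded (h : IsBalancedConfig α p) (z₀ : ℂ) :
    IsHorizontalAnnularEnd (puncturedPlane p) (weierstrassMap α p z₀)
      (Bornology.cobounded ℂ) := by
  set c₀ := weierstrassPrimitive α p (log z₀) z₀ with hc₀
  let B : ℂ → ℂ := fun w => -∑ k, (α k : ℂ) ^ 2 * p k * w * (1 - p k * w)⁻¹
  have hB : ContDiffAt ℝ 1 B 0 := by
    refine (ContDiffAt.sum fun k _ => ?_).neg
    exact (contDiffAt_const.mul contDiffAt_id).mul ((contDiffAt_const.sub
      (contDiffAt_const.mul contDiffAt_id)).inv (by simp))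
  have hBeq : ∀ w : ℂ, w ≠ 0 → polarPrimitive α p w⁻¹ = B w := fun w hw => by
    simp only [polarPrimitive, B]
    congr 1
    refine Finset.sum_congr rfl fun k _ => ?_
    have : w⁻¹ - p k = (1 - p k * w) * w⁻¹ := by field_simp
    rw [this, div_eq_mul_inv, mul_inv, inv_inv]
    ring
  have hu : ContDiffAt ℝ 1 (fun w => exp (starRingEnd ℂ (B w) +
      2 * starRingEnd ℂ (horizontalProj c₀))) 0 :=
    ((conjCLE.contDiff.contDiffAt.comp 0 hB).add contDiffAt_const).cexp
  have hW : {w : ℂ | ∀ j, 1 - p j * w ≠ 0} ∈ 𝓝 (0 : ℂ) := by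
    refine eventually_all.2 fun j => ContinuousAt.eventually_ne (by fun_prop) (by simp)
  have hH : ContinuousAt (fun w => ∑ k, α k * Real.log ‖1 - p k * w‖ - c₀ 2) 0 := by
    refine ContinuousAt.sub ?_ continuousAt_const
    refine tendsto_finsetSum _ fun j _ => ContinuousAt.mul continuousAt_const ?_
    have hj : ContinuousAt (fun w : ℂ => ‖1 - p j * w‖) 0 := by fun_prop
    exact hj.log (by simp)
  refine isHorizontalAnnularEnd_of_chart (τ := Inv.inv) h (Or.inl rfl) inv_inv continuousOn_inv₀
    inv_zero tendsto_inv₀_cobounded' hu (exp_ne_zero _) hW (fun w hw hw0 => ?_)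
    (fun w hw hw0 => ?_) hH (fun w hw hw0 => ?_) ?_
  · refine ⟨inv_ne_zero hw0, fun j hj => hw j ?_⟩
    rw [← hj, inv_mul_cancel₀ hw0, sub_self]
  · rw [annularCoord_eq_exp_conj, conj_horizontalProj_principalLift, hBeq w hw0]
    have h1 : exp (-log w⁻¹) = w := by rw [exp_neg, exp_log (inv_ne_zero hw0), inv_inv]
    conv_rhs => rw [← h1]
    rw [← exp_add, h1]
    congr 1
    push_cast
    ring
  · change heightPotential α p w⁻¹ - c₀ 2 = _
    congr 1
    have hlog : ∀ k, α k * Real.log ‖w⁻¹ - p k‖ =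
        α k * Real.log ‖1 - p k * w‖ + α k * Real.log ‖w⁻¹‖ := fun k => by
      have e1 : w⁻¹ - p k = (1 - p k * w) * w⁻¹ := by field_simp
      rw [e1, norm_mul, Real.log_mul (norm_ne_zero_iff.2 (hw k))
        (norm_ne_zero_iff.2 (inv_ne_zero hw0)), mul_add]
    rw [heightPotential, Finset.sum_congr rfl fun k _ => hlog k, Finset.sum_add_distrib,
      ← Finset.sum_mul, h.sum_eq_zero, zero_mul, add_zero]
  · have h1 := (tendsto_first_coordinate_cobounded (α := α) (p := p)).atTop_add
      (tendsto_const_nhds (x := -(c₀ 0)))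
    refine h1.congr fun z => ?_
    simp [principalLift, hc₀, sub_eq_add_neg]

end AnnularEnds

/-! ### The limiting normals -/

section Normals

open Set Complex Filter

variable {m : ℕ} {α : Fin m → ℝ} {p : Fin m → ℂ}

theorem tendsto_inverseStereographic_zero :
    Tendsto inverseStereographic (𝓝 0) (𝓝 !₂[0, 0, -1]) := by
  have hc : ContinuousAt inverseStereographic 0 := by
    have hn : ContinuousAt (fun w => (1 + normSq w)⁻¹) 0 :=
      ContinuousAt.inv₀ (continuousAt_const.add continuous_normSq.continuousAt) (by simp)
    refine hn.smul ?_
    refine (PiLp.continuous_toLp 2 _).continuousAt.comp (continuousAt_pi.2 fun i => ?_)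
    fin_cases i <;> simp <;> fun_prop
  have h0 : inverseStereographic 0 = !₂[0, 0, -1] := by
    ext i; fin_cases i <;> simp [inverseStereographic]
  rw [← h0]
  exact hc

theorem tendsto_inverseStereographic_cobounded :
    Tendsto inverseStereographic (Bornology.cobounded ℂ) (𝓝 !₂[0, 0, 1]) := by
  have hbound : ∀ (w : ℂ) (a : ℝ), |a| ≤ ‖w‖ →
      |(1 + normSq w)⁻¹ * (2 * a)| ≤ 2 * ‖w‖⁻¹ := fun w a ha => by
    have h0 := norm_nonneg w
    rcases h0.eq_or_lt with h1 | h1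
    · have : a = 0 := by rw [← h1] at ha; simpa using ha
      simp [this]
    · have hpos : 0 < 1 + ‖w‖ ^ 2 := by positivity
      rw [normSq_eq_norm_sq, abs_mul, abs_mul, abs_inv, abs_of_pos hpos, abs_two, inv_mul_eq_div,
        ← div_eq_mul_inv, div_le_div_iff₀ hpos h1]
      nlinarith
  have hinv : Tendsto (fun w : ℂ => 2 * ‖w‖⁻¹) (Bornology.cobounded ℂ) (𝓝 0) := by
    simpa using (tendsto_inv_atTop_zero.comp (tendsto_norm_cobounded_atTop (E := ℂ))).const_mul 2
  have hsmall : ∀ f : ℂ → ℝ, (∀ w, |f w| ≤ ‖w‖) →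
      Tendsto (fun w => (1 + normSq w)⁻¹ * (2 * f w)) (Bornology.cobounded ℂ) (𝓝 0) :=
    fun f hf => squeeze_zero_norm (fun w => hbound w (f w) (hf w)) hinv
  have hsq : Tendsto (fun w : ℂ => 1 + normSq w) (Bornology.cobounded ℂ) atTop := by
    refine tendsto_atTop_add_const_left _ _ ?_
    exact ((tendsto_pow_atTop two_ne_zero).comp tendsto_norm_cobounded_atTop).congr
      fun w => (normSq_eq_norm_sq w).symm
  have hthird : Tendsto (fun w : ℂ => (1 + normSq w)⁻¹ * (normSq w - 1)) (Bornology.cobounded ℂ)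
      (𝓝 1) := by
    have h1 : Tendsto (fun w : ℂ => 1 - 2 * (1 + normSq w)⁻¹) (Bornology.cobounded ℂ)
        (𝓝 (1 - 2 * 0)) := ((tendsto_inv_atTop_zero.comp hsq).const_mul 2).const_sub 1
    rw [mul_zero, sub_zero] at h1
    refine h1.congr fun w => ?_
    have : 1 + normSq w ≠ 0 := by linarith [normSq_nonneg w]
    field_simp
    ring
  refine (((PiLp.continuous_toLp 2 _).tendsto _).comp (tendsto_pi_nhds.2 fun i => ?_) :
    Tendsto (fun w => WithLp.toLp 2 (inverseStereographic w).ofLp) _ _)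
  fin_cases i
  · exact hsmall Complex.re abs_re_le_norm
  · exact hsmall Complex.im abs_im_le_norm
  · exact hthird

theorem tendsto_gaussFunction_zero (h : IsBalancedConfig α p) :
    Tendsto (gaussFunction α p) (𝓝[≠] 0) (𝓝 0) := by
  have hc : ContinuousAt (gaussFunction α p) 0 := by
    refine ContinuousAt.mul continuousAt_id ?_
    unfold heightCoeff
    exact tendsto_finsetSum _ fun k _ => ContinuousAt.div continuousAt_const
      (by fun_prop) (sub_ne_zero.2 (h.point_ne_zero k).symm)
  have h0 : gaussFunction α p 0 = 0 := zero_mul _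
  have := hc.tendsto
  rw [h0] at this
  exact this.mono_left nhdsWithin_le_nhds

/-- Here `G = ∑ α_k + ∑ α_k p_k / (z - p_k)`, and the constant term is zero. -/
theorem tendsto_gaussFunction_cobounded (h : IsBalancedConfig α p) :
    Tendsto (gaussFunction α p) (Bornology.cobounded ℂ) (𝓝 0) := by
  have h1 : Tendsto (fun z => ∑ k, (α k : ℂ) * p k / (z - p k)) (Bornology.cobounded ℂ) (𝓝 0) := by
    have := tendsto_finsetSum (Finset.univ : Finset (Fin m))
      fun k _ => tendsto_div_sub_cobounded ((α k : ℂ) * p k) (p k)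
    rwa [Finset.sum_const_zero] at this
  refine h1.congr' ?_
  have hne : ∀ᶠ z in Bornology.cobounded ℂ, ∀ k, z ≠ p k :=
    eventually_all.2 fun k => 
      (Bornology.isBounded_def.1 (Bornology.isBounded_singleton (x := p k)))
  filter_upwards [hne] with z hz
  have hk : ∀ k, z * ((α k : ℂ) / (z - p k)) = (α k : ℂ) + (α k : ℂ) * p k / (z - p k) :=
    fun k => by
      have := sub_ne_zero.2 (hz k)
      field_simp
      ring
  rw [gaussFunction, heightCoeff, Finset.mul_sum, Finset.sum_congr rfl fun k _ => hk k,
    Finset.sum_add_distrib, ← Complex.ofReal_sum, h.sum_eq_zero, ofReal_zero, zero_add]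

/-- `G` has a simple pole at `p_k` with residue `α_k p_k ≠ 0`. -/
theorem tendsto_gaussFunction_point (h : IsBalancedConfig α p) (k : Fin m) :
    Tendsto (gaussFunction α p) (𝓝[≠] (p k)) (Bornology.cobounded ℂ) := by
  let r : ℂ → ℂ := fun z => ∑ j ∈ Finset.univ.erase k, (α j : ℂ) / (z - p j)
  have hr : ContinuousAt r (p k) :=
    tendsto_finsetSum _ fun j hj => ContinuousAt.div continuousAt_const (by fun_prop)
      (sub_ne_zero.2 (h.inj.ne (Finset.mem_erase.1 hj).1.symm))
  have hlim : ContinuousAt (fun z => z * ((α k : ℂ) + (z - p k) * r z)) (p k) :=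
    continuousAt_id.mul (continuousAt_const.add
      ((continuousAt_id.sub continuousAt_const).mul hr))
  have hne : p k * ((α k : ℂ) + (p k - p k) * r (p k)) ≠ 0 := by
    simp [h.point_ne_zero k, h.neck_ne_zero k]
  have hinv : Tendsto (fun z : ℂ => (z - p k)⁻¹) (𝓝[≠] (p k)) (Bornology.cobounded ℂ) := by
    refine tendsto_inv₀_nhdsNE_zero.comp (tendsto_nhdsWithin_iff.2 ⟨?_, ?_⟩)
    · have : ContinuousAt (fun z : ℂ => z - p k) (p k) := by fun_prop
      have h2 := this.tendsto
      rw [sub_self] at h2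
      exact h2.mono_left nhdsWithin_le_nhds
    · filter_upwards [self_mem_nhdsWithin] with z hz using sub_ne_zero.2 hz
  have hprod : Tendsto (fun z => ‖z * ((α k : ℂ) + (z - p k) * r z)‖ * ‖(z - p k)⁻¹‖) (𝓝[≠] (p k))
      atTop :=
    (hlim.norm.tendsto.mono_left nhdsWithin_le_nhds).pos_mul_atTop (norm_pos_iff.2 hne)
      (tendsto_norm_cobounded_atTop.comp hinv)
  rw [← tendsto_norm_atTop_iff_cobounded]
  refine hprod.congr' ?_
  filter_upwards [self_mem_nhdsWithin] with z hz
  have hs : z - p k ≠ 0 := sub_ne_zero.2 hz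
  rw [← norm_mul]
  congr 1
  rw [gaussFunction, heightCoeff, ← Finset.add_sum_erase _ _ (Finset.mem_univ k)]
  simp only [r]
  field_simp

end Normals

/-! ### The configuration given by the roots of `f_n` -/

theorem isBalancedConfig_legendrePoly {n : ℕ} (hn : 1 ≤ n) {p : Fin n → ℂ}
    (hp : (Finset.univ.val.map p : Multiset ℂ) = (legendrePoly n).roots) {ε : ℝ} (hε : ε ≠ 0) :
    IsBalancedConfig (neckSizes n ε) (catenoidPoints p) where
  pos := n.succ_pos
  inj := catenoidPoints_injective hp
  point_ne_zero := catenoidPoints_ne_zero hp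
  neck_ne_zero := neckSizes_ne_zero hn hε
  sum_eq_zero := sum_neckSizes hn ε
  balance_eq_zero := balance_eq_zero hn hp ε

end

theorem mainTheorem1 (n : ℕ) (hn : 1 ≤ n) (p : Fin n → ℂ)
    (hp : (Finset.univ.val.map p : Multiset ℂ) = (legendrePoly n).roots)
    (ε : ℝ) (hε : ε = 1 ∨ ε = -1)
    (z₀ : ℂ) (hz₀ : z₀ ∈ configDomain p) :
    -- the hypergeometric equation for `f_n`
    (∀ z : ℂ,
      z * (1 - z) * (legendrePoly n).derivative.derivative.eval z +
        (1 + (2 * (n : ℂ) - 1) * z) * (legendrePoly n).derivative.eval z -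
        (n : ℂ) ^ 2 * (legendrePoly n).eval z = 0) ∧
    -- the punctures `0, p_1, …, p_{n+1}` are distinct
    Function.Injective (catenoidPoints p) ∧
    (∀ k, catenoidPoints p k ≠ 0) ∧
    -- the balance equations
    (∀ k, balance (neckSizes n ε) (catenoidPoints p) k = 0) ∧
    -- the periods
    periodSet (configDomain p) (configForm ε p) z₀ = AddSubgroup.zmultiples periodVector ∧
    -- the surface
    ∃ (X : ℂ → E3Quot) (N : ℂ → E3),
      IsWeierstrassMap (configDomain p) (configForm ε p) z₀ X ∧
      IsMinimalImmersion (configDomain p) X ∧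
      IsCompleteSurface (configDomain p) X ∧
      IsUnitNormalField (configDomain p) X N ∧
      -- the annular ends at `0` and `∞`, with limiting normal `(0, 0, -1)`
      (IsHorizontalAnnularEnd (configDomain p) X (𝓝[≠] 0) ∧
        Filter.Tendsto N (𝓝[≠] 0) (𝓝 !₂[0, 0, -1])) ∧
      (IsHorizontalAnnularEnd (configDomain p) X (Bornology.cobounded ℂ) ∧
        Filter.Tendsto N (Bornology.cobounded ℂ) (𝓝 !₂[0, 0, -1])) ∧
      -- the catenoidal ends at `p_1, …, p_{n+1}`, with limiting normal `(0, 0, 1)`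
      (∀ k, IsCatenoidalEnd (configDomain p) X (catenoidPoints p k) (-neckSizes n ε k) ∧
        Filter.Tendsto N (𝓝[≠] (catenoidPoints p k)) (𝓝 !₂[0, 0, 1])) := by
  have hε0 : ε ≠ 0 := by rcases hε with rfl | rfl <;> norm_num
  have h := isBalancedConfig_legendrePoly hn hp hε0
  exact ⟨legendrePoly_ode_eval n, h.inj, h.point_ne_zero, h.balance_eq_zero, periodSet_eq h hz₀,
    weierstrassMap _ _ z₀, _, isWeierstrassMap_weierstrassMap h z₀, isMinimalImmersion_weierstrassMap h,
    isCompleteSurface_weierstrassMap h, isUnitNormalField_weierstrassMap h,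
    ⟨isHorizontalAnnularEnd_zero h z₀,
      tendsto_inverseStereographic_zero.comp (tendsto_gaussFunction_zero h)⟩,
    ⟨isHorizontalAnnularEnd_cobounded h z₀,
      tendsto_inverseStereographic_zero.comp (tendsto_gaussFunction_cobounded h)⟩,
    fun k => ⟨isCatenoidalEnd_weierstrassMap h z₀ k,
      tendsto_inverseStereographic_cobounded.comp (tendsto_gaussFunction_point h k)⟩⟩
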